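/- For real $\alpha$ and $\rho>0$ let $B_{\alpha,\rho}$ be the space of smooth functions $f:\mathbb R\to\mathbb R$ with $$\|f\|_{B_{\alpha,\rho}}=\sum_{n=0}^{\infty}\frac{\|D^nf\|_{L^2(\mathbb R)}}{n!}\,n^{\alpha}\rho^{n}<\infty,$$ where $n^{\alpha}$ is read as $1$ for $n=0$, and let $\|f\|_{H^2}=\sum_{j=0}^{2}\|D^jf\|_{L^2(\mathbb R)}$. **Theorem.** There is an absolute constant $\kappa>0$ such that for all $\alpha>2$ and $\rho_0>0$ there are a constant $c_3>0$, depending only on $\alpha$ and $\rho_0$, and a function $\gamma:\mathbb R\to(0,\infty)$, depending only on $\alpha$ and $\rho_0$, with the following property. Let $u^{(0)}\in B_{\alpha,\rho_0}$, let $T>0$ satisfy $T\,\|u^{(0)}\|_{H^2}\le\kappa$, and put $$\rho_1=\rho_0\,e^{-\gamma T},\qquad \gamma=\gamma\bigl(\|u^{(0)}\|_{B_{\alpha,\rho_0}}\bigr).$$ Then there is a solution $u$ of Burgers' equation $u_t+u\,u_x=0$ on $[0,T]\times\mathbb R$ with $u(0,\cdot)=u^{(0)}$, real analytic in $(t,x)$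 on a neighbourhood of $[0,T]\times\mathbb R$, such that: 1. $u$ extends every given solution: if $T_a>0$ and $v$ is a $C^1$ (in particular, if $v$ is an analytic) solution of Burgers' equation on $[0,T_a]\times\mathbb R$ with $v(0,\cdot)=u^{(0)}$, then $u=v$ on $[0,\min(T_a,T)]\times\mathbb R$; 2. for every $\rho'''$ with $0<\rho'''<\rho_1$, $u\in C^k([0,T],B_{\alpha,\rho'''})$ for all $k\in\mathbb N$, and $$\sup_{t\in[0,T]}\|u(t,\cdot)\|_{B_{\alpha,\rho'''}}\le c_5\,\|u^{(0)}\|_{B_{\alpha,\rho_0}},\qquad c_5=c_3\,\frac{\rho_1}{\rho_1-\rho'''}.$$ -/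

import Mathlib

open MeasureTheory Set
open scoped ENNReal ContDiff

/-- The weight `n ^ α * ρ ^ n / n!` of the `n`-th term of the norm. For `n = 0` the factor `n ^ α`
is read as `1`, so that the term of order zero is the `L²` norm of the function itself. -/
noncomputable def bWeight (α ρ : ℝ) (n : ℕ) : ℝ≥0∞ :=
  ENNReal.ofReal (((max n 1 : ℕ) : ℝ) ^ α * ρ ^ n / (n.factorial : ℝ))

/-- The norm `∑ₙ ‖Dⁿ f‖_{L²(ℝ)} n ^ α ρ ^ n / n!` as an extended nonnegative number. -/
noncomputable def bENorm (α ρ : ℝ) (f : ℝ → ℝ) : ℝ≥0∞ :=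
  ∑' n : ℕ, bWeight α ρ n * eLpNorm (iteratedDeriv n f) 2 volume

/-- The Sobolev norm `‖f‖_{H²(ℝ)} = ‖f‖_{L²} + ‖f'‖_{L²} + ‖f''‖_{L²}` of a smooth function. -/
noncomputable def sobolevH2Norm (f : ℝ → ℝ) : ℝ :=
  ∑ j ∈ Finset.range 3, (eLpNorm (iteratedDeriv j f) 2 volume).toReal

theorem contDiff_nat_of_smooth {f : ℝ → ℝ} (hf : ContDiff ℝ ∞ f) (n : ℕ) : ContDiff ℝ n f :=
  hf.of_le (by exact_mod_cast le_top)

theorem aesm_iteratedDeriv {f : ℝ → ℝ} (hf : ContDiff ℝ ∞ f) (n : ℕ) :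
    AEStronglyMeasurable (iteratedDeriv n f) volume :=
  (hf.continuous_iteratedDeriv n (by exact_mod_cast le_top)).aestronglyMeasurable

theorem bENorm_zero (α ρ : ℝ) : bENorm α ρ 0 = 0 := by
  have h : ∀ n : ℕ, iteratedDeriv n (0 : ℝ → ℝ) = 0 := fun n => by
    ext x
    simp
  simp [bENorm, h]

theorem bENorm_add_le (α ρ : ℝ) {f g : ℝ → ℝ} (hf : ContDiff ℝ ∞ f) (hg : ContDiff ℝ ∞ g) :
    bENorm α ρ (f + g) ≤ bENorm α ρ f + bENorm α ρ g := by
  unfold bENorm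
  rw [← ENNReal.tsum_add]
  refine ENNReal.tsum_le_tsum fun n => ?_
  rw [← mul_add]
  gcongr
  have h : iteratedDeriv n (f + g) = iteratedDeriv n f + iteratedDeriv n g := by
    ext x
    exact iteratedDeriv_add (contDiff_nat_of_smooth hf n).contDiffAt
      (contDiff_nat_of_smooth hg n).contDiffAt
  rw [h]
  exact eLpNorm_add_le (aesm_iteratedDeriv hf n) (aesm_iteratedDeriv hg n) (by norm_num)

theorem bENorm_smul (α ρ c : ℝ) {f : ℝ → ℝ} (hf : ContDiff ℝ ∞ f) :
    bENorm α ρ (c • f) = ‖c‖ₑ * bENorm α ρ f := by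
  unfold bENorm
  rw [← ENNReal.tsum_mul_left]
  congr 1
  ext n
  have h : iteratedDeriv n (c • f) = c • iteratedDeriv n f := by
    ext x
    exact iteratedDeriv_const_smul (contDiff_nat_of_smooth hf n).contDiffAt c
  rw [h, eLpNorm_const_smul]
  ring

theorem eq_zero_of_bENorm_eq_zero {α ρ : ℝ} {f : ℝ → ℝ} (hf : ContDiff ℝ ∞ f)
    (h : bENorm α ρ f = 0) : f = 0 := by
  have h0 := ENNReal.tsum_eq_zero.1 h 0
  simp only [bWeight, iteratedDeriv_zero] at h0
  have h1 : eLpNorm f 2 (volume : Measure ℝ) = 0 := by simpa using h0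
  rw [eLpNorm_eq_zero_iff hf.continuous.aestronglyMeasurable (by norm_num)] at h1
  exact hf.continuous.ae_eq_iff_eq volume continuous_zero |>.1 h1

/-- The smooth functions on `ℝ` whose norm `∑ₙ ‖Dⁿ f‖_{L²(ℝ)} n ^ α ρ ^ n / n!` is finite. -/
noncomputable def bSubmodule (α ρ : ℝ) : Submodule ℝ (ℝ → ℝ) where
  carrier := {f | ContDiff ℝ ∞ f ∧ bENorm α ρ f ≠ ⊤}
  add_mem' := fun hf hg => ⟨hf.1.add hg.1,
    ne_top_of_le_ne_top (ENNReal.add_ne_top.2 ⟨hf.2, hg.2⟩) (bENorm_add_le α ρ hf.1 hg.1)⟩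
  zero_mem' := ⟨contDiff_const, by simp [bENorm_zero]⟩
  smul_mem' := fun c f hf => ⟨hf.1.const_smul c, by
    rw [bENorm_smul α ρ c hf.1]
    exact ENNReal.mul_ne_top enorm_ne_top hf.2⟩

/-- The space `B_{α,ρ}`. -/
def BSpace (α ρ : ℝ) : Type := bSubmodule α ρ

noncomputable instance (α ρ : ℝ) : AddCommGroup (BSpace α ρ) :=
  inferInstanceAs (AddCommGroup (bSubmodule α ρ))

noncomputable instance (α ρ : ℝ) : Module ℝ (BSpace α ρ) :=
  inferInstanceAs (Module ℝ (bSubmodule α ρ))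

/-- The function on `ℝ` underlying an element of `B_{α,ρ}`. -/
def BSpace.toFun {α ρ : ℝ} (f : BSpace α ρ) : ℝ → ℝ := Subtype.val f

theorem BSpace.smooth {α ρ : ℝ} (f : BSpace α ρ) : ContDiff ℝ ∞ f.toFun := f.2.1

theorem BSpace.bENorm_ne_top {α ρ : ℝ} (f : BSpace α ρ) : bENorm α ρ f.toFun ≠ ⊤ := f.2.2

/-- The norm of `B_{α,ρ}`, as a norm on an additive group. -/
noncomputable def bGroupNorm (α ρ : ℝ) : AddGroupNorm (BSpace α ρ) where
  toFun f := (bENorm α ρ f.toFun).toReal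
  map_zero' := by
    change (bENorm α ρ 0).toReal = 0
    simp [bENorm_zero]
  add_le' f g := by
    rw [← ENNReal.toReal_add f.bENorm_ne_top g.bENorm_ne_top]
    exact ENNReal.toReal_mono (ENNReal.add_ne_top.2 ⟨f.bENorm_ne_top, g.bENorm_ne_top⟩)
      (bENorm_add_le α ρ f.smooth g.smooth)
  neg' f := by
    have h : (-f).toFun = (-1 : ℝ) • f.toFun := by
      change -f.toFun = _
      simp
    rw [h, bENorm_smul α ρ (-1) f.smooth]
    simp
  eq_zero_of_map_eq_zero' f h := by
    rcases (ENNReal.toReal_eq_zero_iff _).1 h with h | h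
    · exact Subtype.ext (eq_zero_of_bENorm_eq_zero f.smooth h)
    · exact absurd h f.bENorm_ne_top

noncomputable instance (α ρ : ℝ) : NormedAddCommGroup (BSpace α ρ) :=
  (bGroupNorm α ρ).toNormedAddCommGroup

theorem BSpace.norm_def {α ρ : ℝ} (f : BSpace α ρ) : ‖f‖ = (bENorm α ρ f.toFun).toReal := rfl

noncomputable instance (α ρ : ℝ) : NormedSpace ℝ (BSpace α ρ) where
  norm_smul_le c f := by
    rw [BSpace.norm_def, BSpace.norm_def]
    have h : (c • f).toFun = c • f.toFun := rfl
    rw [h, bENorm_smul α ρ c f.smooth, ENNReal.toReal_mul]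
    simp

/-- `u` (with `u t x` the value at time `t` and position `x`) is a `C¹` solution of the Burgers
equation `u_t + u u_x = 0` on `[0, T] × ℝ`; the time derivative is one-sided at the end points. -/
structure IsBurgersSolution (T : ℝ) (u : ℝ → ℝ → ℝ) : Prop where
  contDiffOn : ContDiffOn ℝ 1 (Function.uncurry u) (Icc 0 T ×ˢ univ)
  equation : ∀ t ∈ Icc 0 T, ∀ x : ℝ,
    HasDerivWithinAt (fun s => u s x) (-(u t x * deriv (u t) x)) (Icc 0 T) t

/-! The solution is built by characteristics: with f the initial value, u is constant along x + t
f(x). A Sobolev inequality gives |f'| ≤ L for some L at most the H² norm, so for T L ≤ 1/2 the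
Jacobian J = 1 + t f' stays in [1/2, 3/2]. The flow map is then a bijection at each time, and the
analytic inverse function theorem makes u analytic in (t, x) (`analyticAt_burgersSol`). Any C¹
solution v with the same initial value equals v(0, x) on the line through x of slope v(0, x), by
Gronwall (`IsBurgersSolution.apply_flowMap`), so it coincides with u.

The quantitative part works with w_n(t, x), the n-th space derivative of u at the point x + t f(x).
The Leibniz rule gives ∂ₜ w_n = -∑_{1 ≤ j ≤ n} C(n, j) w_j w_{n+1-j}. The two extreme terms add up
to (n + 1) w_1 w_n, and J w_1 = f' = ∂ₜ J, so J^(n+1) is an integrating factor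
(`hasDerivAt_pow_mul_lagDeriv`). What remains involves only orders 2 to n - 1, and no derivative is
lost. Strong induction on n then yields ‖w_n(t)‖ ≤ A_n exp(γ (n - 2) t) in L²
(`eLpNorm_lagDeriv_le`), where A_n is a multiple of n! / (n^α ρ₀^n). The quadratic source reproduces
A_n up to a factor C (n - 2) because ∑ j^(1-α) converges for α > 2
(`exists_sum_choose_mul_bBound_le`), and the time integral of the exponential absorbs that factor.
The growth exp(γ n T) amounts to replacing ρ₀ by ρ₁ = ρ₀ exp(-γ T), and a geometric series in ρ/ρ₁
gives the norm bound.

For regularity in time, the time derivatives of u are explicit: ∂ₜᵏ u = (-1)^k / (k + 1) ∂ₓᵏ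
(u^(k+1)). Factorial L² bounds for all radii below ρ₁ survive products and space derivatives, hence
hold for every ∂ₜᵏ u. A Taylor remainder estimate turns these pointwise derivatives into derivatives
with values in B_{α,ρ} (`hasDerivWithinAt_toBSpace`). -/

/-- The partial derivative in the space variable of a function of time and space. -/
noncomputable def spaceDeriv (G : ℝ → ℝ → ℝ) : ℝ → ℝ → ℝ := fun t x => deriv (G t) x

/-- The partial derivative in the time variable of a function of time and space. -/
noncomputable def timeDeriv (G : ℝ → ℝ → ℝ) : ℝ → ℝ → ℝ := fun t x => deriv (fun s => G s x) t

/-! ### Partial derivatives of functions analytic in time and space -/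

section PartialDerivatives

variable {G : ℝ → ℝ → ℝ} {t x : ℝ}

theorem hasDerivAt_space_fderiv (h : DifferentiableAt ℝ (Function.uncurry G) (t, x)) :
    HasDerivAt (G t) (fderiv ℝ (Function.uncurry G) (t, x) (0, 1)) x := by
  have h1 : HasDerivAt (fun y : ℝ => (t, y)) ((0 : ℝ), (1 : ℝ)) x :=
    (hasDerivAt_const x t).prodMk (hasDerivAt_id x)
  exact h.hasFDerivAt.comp_hasDerivAt x h1

theorem hasDerivAt_time_fderiv (h : DifferentiableAt ℝ (Function.uncurry G) (t, x)) :
    HasDerivAt (fun s => G s x) (fderiv ℝ (Function.uncurry G) (t, x) (1, 0)) t := by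
  have h1 : HasDerivAt (fun s : ℝ => (s, x)) ((1 : ℝ), (0 : ℝ)) t :=
    (hasDerivAt_id t).prodMk (hasDerivAt_const t x)
  exact h.hasFDerivAt.comp_hasDerivAt t h1

theorem uncurry_spaceDeriv_eventuallyEq (h : AnalyticAt ℝ (Function.uncurry G) (t, x)) :
    Function.uncurry (spaceDeriv G) =ᶠ[nhds (t, x)]
      fun q => fderiv ℝ (Function.uncurry G) q (0, 1) := by
  filter_upwards [h.eventually_analyticAt] with q hq
  exact (hasDerivAt_space_fderiv (t := q.1) (x := q.2) hq.differentiableAt).deriv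

theorem uncurry_timeDeriv_eventuallyEq (h : AnalyticAt ℝ (Function.uncurry G) (t, x)) :
    Function.uncurry (timeDeriv G) =ᶠ[nhds (t, x)]
      fun q => fderiv ℝ (Function.uncurry G) q (1, 0) := by
  filter_upwards [h.eventually_analyticAt] with q hq
  exact (hasDerivAt_time_fderiv (t := q.1) (x := q.2) hq.differentiableAt).deriv

theorem AnalyticAt.spaceDeriv (h : AnalyticAt ℝ (Function.uncurry G) (t, x)) :
    AnalyticAt ℝ (Function.uncurry (spaceDeriv G)) (t, x) :=
  (((ContinuousLinearMap.apply ℝ ℝ ((0 : ℝ), (1 : ℝ))).analyticAt _).comp h.fderiv).congr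
    (uncurry_spaceDeriv_eventuallyEq h).symm

theorem AnalyticAt.timeDeriv (h : AnalyticAt ℝ (Function.uncurry G) (t, x)) :
    AnalyticAt ℝ (Function.uncurry (timeDeriv G)) (t, x) :=
  (((ContinuousLinearMap.apply ℝ ℝ ((1 : ℝ), (0 : ℝ))).analyticAt _).comp h.fderiv).congr
    (uncurry_timeDeriv_eventuallyEq h).symm

theorem AnalyticAt.hasDerivAt_space (h : AnalyticAt ℝ (Function.uncurry G) (t, x)) :
    HasDerivAt (G t) (_root_.spaceDeriv G t x) x :=
  (hasDerivAt_space_fderiv h.differentiableAt).differentiableAt.hasDerivAt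

theorem AnalyticAt.hasDerivAt_time (h : AnalyticAt ℝ (Function.uncurry G) (t, x)) :
    HasDerivAt (fun s => G s x) (_root_.timeDeriv G t x) t :=
  (hasDerivAt_time_fderiv h.differentiableAt).differentiableAt.hasDerivAt

theorem AnalyticAt.timeDeriv_spaceDeriv (h : AnalyticAt ℝ (Function.uncurry G) (t, x)) :
    _root_.timeDeriv (_root_.spaceDeriv G) t x = _root_.spaceDeriv (_root_.timeDeriv G) t x := by
  have hs := hasDerivAt_time_fderiv h.spaceDeriv.differentiableAt
  have ht := hasDerivAt_space_fderiv h.timeDeriv.differentiableAt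
  rw [(uncurry_spaceDeriv_eventuallyEq h).fderiv_eq] at hs
  rw [(uncurry_timeDeriv_eventuallyEq h).fderiv_eq] at ht
  have e1 := hs.deriv
  have e2 := ht.deriv
  change _root_.timeDeriv (_root_.spaceDeriv G) t x = _ at e1
  change _root_.spaceDeriv (_root_.timeDeriv G) t x = _ at e2
  have hd : DifferentiableAt ℝ (fderiv ℝ (Function.uncurry G)) (t, x) := h.fderiv.differentiableAt
  rw [e1, e2, fderiv_clm_apply hd (differentiableAt_const _),
    fderiv_clm_apply hd (differentiableAt_const _)]
  have hsymm : IsSymmSndFDerivAt ℝ (Function.uncurry G) (t, x) :=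
    h.contDiffAt.isSymmSndFDerivAt_of_omega
  simpa using hsymm (1, 0) (0, 1)

theorem iteratedDeriv_eq_spaceDeriv_iterate (G : ℝ → ℝ → ℝ) (n : ℕ) (t : ℝ) :
    iteratedDeriv n (G t) = (spaceDeriv^[n] G) t := by
  induction n with
  | zero => simp
  | succ n ih =>
    rw [iteratedDeriv_succ, ih, Function.iterate_succ_apply']
    rfl

theorem AnalyticAt.spaceDeriv_iterate (h : AnalyticAt ℝ (Function.uncurry G) (t, x)) (n : ℕ) :
    AnalyticAt ℝ (Function.uncurry (_root_.spaceDeriv^[n] G)) (t, x) := by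
  induction n with
  | zero => exact h
  | succ n ih =>
    rw [Function.iterate_succ_apply']
    exact ih.spaceDeriv

theorem timeDeriv_spaceDeriv_iterate (h : ∀ x, AnalyticAt ℝ (Function.uncurry G) (t, x)) (n : ℕ) :
    timeDeriv (spaceDeriv^[n] G) t = (spaceDeriv^[n] (timeDeriv G)) t := by
  induction n with
  | zero => rfl
  | succ n ih =>
    ext x
    rw [Function.iterate_succ_apply', Function.iterate_succ_apply',
      ((h x).spaceDeriv_iterate n).timeDeriv_spaceDeriv]
    unfold spaceDeriv at ih ⊢
    rw [ih]

theorem contDiff_space (h : ∀ x, AnalyticAt ℝ (Function.uncurry G) (t, x)) {n : WithTop ℕ∞} :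
    ContDiff ℝ n (G t) := by
  refine contDiff_iff_contDiffAt.2 fun x => ?_
  have h1 : AnalyticAt ℝ (fun y : ℝ => (t, y)) x := analyticAt_const.prod analyticAt_id
  exact ((h x).fun_comp h1).contDiffAt

end PartialDerivatives

/-! ### Sobolev, Minkowski and time-increment inequalities in L² -/

section Lebesgue

/-- A pointwise Sobolev inequality on the line. -/
theorem enorm_le_eLpNorm_add_eLpNorm_deriv {f f' : ℝ → ℝ} (hf : ∀ x, HasDerivAt f (f' x) x)
    (hc : Continuous f') (x : ℝ) :
    ‖f x‖ₑ ≤ eLpNorm f 2 volume + eLpNorm f' 2 volume := by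
  have hfc : Continuous f := continuous_iff_continuousAt.2 fun x => (hf x).continuousAt
  -- Averaging over the unit interval (x, x + 1] uses a probability measure, so L¹ ≤ L² costs no
  -- constant.
  set μ : Measure ℝ := volume.restrict (Ioc x (x + 1)) with hμ
  have : IsProbabilityMeasure μ := ⟨by simp [hμ]⟩
  have key : ∀ y ∈ Ioc x (x + 1), ‖f x‖ₑ ≤ ‖f y‖ₑ + ∫⁻ z, ‖f' z‖ₑ ∂μ := by
    intro y hy
    have h1 : ∫ z in x..y, f' z = f y - f x :=
      intervalIntegral.integral_eq_sub_of_hasDerivAt (fun z _ => hf z) (hc.intervalIntegrable _ _)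
    have h2 : f x = f y - ∫ z in x..y, f' z := by rw [h1]; ring
    rw [h2]
    refine (enorm_sub_le).trans (add_le_add le_rfl ?_)
    rw [intervalIntegral.integral_of_le hy.1.le]
    refine (enorm_integral_le_lintegral_enorm _).trans ?_
    exact lintegral_mono_set (Ioc_subset_Ioc_right hy.2)
  have h3 : ‖f x‖ₑ ≤ (∫⁻ z, ‖f z‖ₑ ∂μ) + ∫⁻ z, ‖f' z‖ₑ ∂μ := by
    calc ‖f x‖ₑ = ∫⁻ _, ‖f x‖ₑ ∂μ := by simp
      _ ≤ ∫⁻ y, (‖f y‖ₑ + ∫⁻ z, ‖f' z‖ₑ ∂μ) ∂μ :=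
        setLIntegral_mono' measurableSet_Ioc key
      _ = _ := by rw [lintegral_add_right _ measurable_const]; simp
  have h4 : ∀ h : ℝ → ℝ, Continuous h → ∫⁻ z, ‖h z‖ₑ ∂μ ≤ eLpNorm h 2 volume := by
    intro h hh
    rw [← eLpNorm_one_eq_lintegral_enorm]
    exact (eLpNorm_le_eLpNorm_of_exponent_le (by norm_num) hh.aestronglyMeasurable).trans
      (eLpNorm_restrict_le _ _ _ _)
  exact h3.trans (add_le_add (h4 f hfc) (h4 f' hc))

theorem lintegral_mul_le_of_lintegral_sq_le {X : Type*} [MeasurableSpace X] {μ : Measure X}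
    {f g : X → ℝ≥0∞} (hf : AEMeasurable f μ) (hg : AEMeasurable g μ) {a b : ℝ≥0∞}
    (ha : ∫⁻ x, f x ^ 2 ∂μ ≤ a ^ 2) (hb : ∫⁻ x, g x ^ 2 ∂μ ≤ b ^ 2) :
    ∫⁻ x, f x * g x ∂μ ≤ a * b := by
  have h := ENNReal.lintegral_mul_le_Lp_mul_Lq μ (Real.HolderConjugate.two_two) hf hg
  refine h.trans (mul_le_mul' ?_ ?_)
  · refine (ENNReal.rpow_le_rpow (z := 1 / 2) (by simpa using ha) (by norm_num)).trans ?_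
    rw [← ENNReal.rpow_natCast, ← ENNReal.rpow_mul]; norm_num
  · refine (ENNReal.rpow_le_rpow (z := 1 / 2) (by simpa using hb) (by norm_num)).trans ?_
    rw [← ENNReal.rpow_natCast, ← ENNReal.rpow_mul]; norm_num

/-- Minkowski's integral inequality in `L²`. -/
theorem lintegral_sq_lintegral_le {S X : Type*} [MeasurableSpace S] [MeasurableSpace X]
    {ν : Measure S} {μ : Measure X} [SFinite ν] [SFinite μ] {f : S → X → ℝ≥0∞}
    (hf : Measurable (Function.uncurry f)) {g : S → ℝ≥0∞} (hg : Measurable g)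
    (h : ∀ᵐ s ∂ν, ∫⁻ x, f s x ^ 2 ∂μ ≤ g s ^ 2) :
    ∫⁻ x, (∫⁻ s, f s x ∂ν) ^ 2 ∂μ ≤ (∫⁻ s, g s ∂ν) ^ 2 := by
  have hfs : ∀ s, Measurable (f s) := fun s => hf.comp measurable_prodMk_left
  have hfx : ∀ x, Measurable fun s => f s x := fun x => hf.comp measurable_prodMk_right
  -- The square of the inner integral becomes a double integral over s and r; Tonelli moves x
  -- innermost, and Cauchy–Schwarz bounds each pair by g(s) g(r).
  have e1 : ∀ x, (∫⁻ s, f s x ∂ν) ^ 2 = ∫⁻ s, ∫⁻ r, f s x * f r x ∂ν ∂ν := by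
    intro x
    rw [sq, ← lintegral_mul_const _ (hfx x)]
    refine lintegral_congr fun s => ?_
    rw [lintegral_const_mul _ (hfx x)]
  have hm : ∀ s, Measurable (Function.uncurry fun x r => f s x * f r x) := fun s =>
    ((hfs s).comp measurable_fst).mul (hf.comp (measurable_snd.prodMk measurable_fst))
  have hm3 : Measurable fun p : (X × S) × S => f p.1.2 p.1.1 * f p.2 p.1.1 :=
    (hf.comp ((measurable_snd.comp measurable_fst).prodMk
      (measurable_fst.comp measurable_fst))).mul
    (hf.comp (measurable_snd.prodMk (measurable_fst.comp measurable_fst)))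
  calc ∫⁻ x, (∫⁻ s, f s x ∂ν) ^ 2 ∂μ = ∫⁻ x, ∫⁻ s, ∫⁻ r, f s x * f r x ∂ν ∂ν ∂μ :=
        lintegral_congr e1
    _ = ∫⁻ s, ∫⁻ x, ∫⁻ r, f s x * f r x ∂ν ∂μ ∂ν :=
        lintegral_lintegral_swap (hm3.lintegral_prod_right').aemeasurable
    _ = ∫⁻ s, ∫⁻ r, ∫⁻ x, f s x * f r x ∂μ ∂ν ∂ν :=
        lintegral_congr fun s => lintegral_lintegral_swap (hm s).aemeasurable
    _ ≤ ∫⁻ s, ∫⁻ r, g s * g r ∂ν ∂ν := by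
        refine lintegral_mono_ae ?_
        filter_upwards [h] with s hs
        refine lintegral_mono_ae ?_
        filter_upwards [h] with r hr
        exact lintegral_mul_le_of_lintegral_sq_le (hfs s).aemeasurable (hfs r).aemeasurable hs hr
    _ = (∫⁻ s, g s ∂ν) ^ 2 := by
        rw [sq, ← lintegral_mul_const _ hg]
        refine lintegral_congr fun s => ?_
        rw [lintegral_const_mul _ hg]

theorem lintegral_enorm_sq_eq_eLpNorm_sq {X : Type*} [MeasurableSpace X] (μ : Measure X)
    (f : X → ℝ) : ∫⁻ x, ‖f x‖ₑ ^ 2 ∂μ = eLpNorm f 2 μ ^ 2 := by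
  rw [eLpNorm_eq_lintegral_rpow_enorm_toReal (by norm_num) (by norm_num), ← ENNReal.rpow_natCast,
    ← ENNReal.rpow_mul]
  norm_num

/-- The `L²` norm of an increment in time is at most the time integral of a bound for the `L²` norm
of the time derivative. -/
theorem eLpNorm_sub_le_integral {a b : ℝ} (hab : a ≤ b) {F f : ℝ → ℝ → ℝ}
    (hF : ∀ x, ∀ s ∈ Icc a b, HasDerivAt (fun s => F s x) (f s x) s)
    (hf : ContinuousOn (Function.uncurry f) (Icc a b ×ˢ univ)) {g : ℝ → ℝ} (hg : Continuous g)
    (hg0 : ∀ s ∈ Icc a b, 0 ≤ g s)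
    (h : ∀ s ∈ Icc a b, eLpNorm (f s) 2 volume ≤ ENNReal.ofReal (g s)) :
    eLpNorm (fun x => F b x - F a x) 2 volume ≤ ENNReal.ofReal (∫ s in a..b, g s) := by
  -- Clamping time to [a, b] makes the integrand continuous on the whole plane, hence jointly
  -- measurable, without changing it on [a, b].
  set c : ℝ → ℝ := fun s => max a (min s b) with hc
  have hcm : ∀ s, c s ∈ Icc a b := fun s => ⟨le_max_left _ _, max_le hab (min_le_right _ _)⟩
  have hce : ∀ s ∈ Icc a b, c s = s := fun s hs => by simp [hc, hs.1, hs.2]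
  have hcc : Continuous c := by fun_prop
  have hfc : Continuous (Function.uncurry fun s x => f (c s) x) :=
    hf.comp_continuous (f := fun p : ℝ × ℝ => (c p.1, p.2)) (by fun_prop)
      fun p => ⟨hcm p.1, mem_univ _⟩
  have hsub : ∀ {s}, s ∈ Ioc a b → s ∈ Icc a b := fun hs => Ioc_subset_Icc_self hs
  have hmem : ∀ᵐ s ∂(volume.restrict (Ioc a b)), s ∈ Ioc a b := ae_restrict_mem measurableSet_Ioc
  have hint : ∀ x, F b x - F a x = ∫ s in Ioc a b, f (c s) x := by
    intro x
    have hi : IntervalIntegrable (fun s => f s x) volume a b := by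
      refine ContinuousOn.intervalIntegrable ?_
      rw [uIcc_of_le hab]
      exact hf.comp (f := fun s : ℝ => (s, x)) (by fun_prop) fun s hs => ⟨hs, mem_univ _⟩
    rw [← intervalIntegral.integral_eq_sub_of_hasDerivAt (f := fun s => F s x)
      (by rw [uIcc_of_le hab]; exact hF x) hi, intervalIntegral.integral_of_le hab]
    exact setIntegral_congr_fun measurableSet_Ioc fun s hs => by simp only [hce s (hsub hs)]
  have hgi : ENNReal.ofReal (∫ s in a..b, g s) = ∫⁻ s in Ioc a b, ENNReal.ofReal (g s) := by
    rw [intervalIntegral.integral_of_le hab]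
    refine ofReal_integral_eq_lintegral_ofReal (hg.integrableOn_Ioc) ?_
    filter_upwards [hmem] with s hs using hg0 s (hsub hs)
  have key := lintegral_sq_lintegral_le (ν := volume.restrict (Ioc a b)) (μ := volume)
    (f := fun s x => ‖f (c s) x‖ₑ) (g := fun s => ENNReal.ofReal (g s))
    (hfc.measurable.enorm) (hg.measurable.ennreal_ofReal) (by
      filter_upwards [hmem] with s hs
      rw [lintegral_enorm_sq_eq_eLpNorm_sq, hce s (hsub hs)]
      exact pow_le_pow_left' (h s (hsub hs)) 2)
  rw [hgi, ← ENNReal.pow_le_pow_left_iff (two_ne_zero), ← lintegral_enorm_sq_eq_eLpNorm_sq]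
  refine le_trans (lintegral_mono fun x => ?_) key
  rw [hint x]
  exact pow_le_pow_left' (enorm_integral_le_lintegral_enorm _) 2

theorem eLpNorm_le_ofReal_mul {f g : ℝ → ℝ} {c : ℝ} (h : ∀ x, |f x| ≤ c * |g x|) :
    eLpNorm f 2 volume ≤ ENNReal.ofReal c * eLpNorm g 2 volume :=
  eLpNorm_le_mul_eLpNorm_of_ae_le_mul (Filter.Eventually.of_forall h) 2

end Lebesgue

/-- A smooth function with derivatives of order `n` bounded by `C r ^ n n!` is analytic. -/
theorem analyticAt_of_iteratedDeriv_bound {f : ℝ → ℝ} (hf : ContDiff ℝ ∞ f) {C r : ℝ} (hr : 0 < r)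
    (h : ∀ n x, |iteratedDeriv n f x| ≤ C * r ^ n * n.factorial) (x : ℝ) : AnalyticAt ℝ f x := by
  refine ⟨FormalMultilinearSeries.ofScalars ℝ fun n => iteratedDeriv n f x / n.factorial, ?_⟩
  rw [hasFPowerSeriesAt_iff]
  have hev : ∀ᶠ z in nhds (0 : ℝ), |z| * r < 1 := by
    have : ContinuousAt (fun z : ℝ => |z| * r) 0 := by fun_prop
    exact this.eventually_lt_const (by simp)
  filter_upwards [hev] with z hz
  have hzr : 0 ≤ |z| * r := by positivity
  have hcoef : ∀ n : ℕ, |iteratedDeriv n f x / n.factorial| ≤ C * r ^ n := by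
    intro n
    have hn : (0 : ℝ) < n.factorial := by exact_mod_cast n.factorial_pos
    rw [abs_div, abs_of_pos hn, div_le_iff₀ hn]
    exact h n x
  have hbd : ∀ n : ℕ, ‖z ^ n * (iteratedDeriv n f x / n.factorial)‖ ≤ C * (|z| * r) ^ n := by
    intro n
    rw [norm_mul, norm_pow, Real.norm_eq_abs, Real.norm_eq_abs]
    calc |z| ^ n * |iteratedDeriv n f x / n.factorial| ≤ |z| ^ n * (C * r ^ n) := by
          gcongr; exact hcoef n
      _ = C * (|z| * r) ^ n := by rw [mul_pow]; ring
  have hsum : Summable fun n : ℕ => z ^ n * (iteratedDeriv n f x / n.factorial) :=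
    Summable.of_norm_bounded ((summable_geometric_of_lt_one hzr hz).mul_left C) hbd
  have hgoal : HasSum (fun n : ℕ => z ^ n * (iteratedDeriv n f x / n.factorial)) (f (x + z)) := by
    rw [hsum.hasSum_iff_tendsto_nat, ← Filter.tendsto_add_atTop_iff_nat 1]
    -- The Lagrange remainder is controlled by the derivative of order n + 1 at an intermediate
    -- point, hence by a geometric term; z = 0 is separate because Lagrange's form needs two
    -- distinct points.
    have hrem : ∀ n : ℕ, |f (x + z) - ∑ k ∈ Finset.range (n + 1),
        z ^ k * (iteratedDeriv k f x / k.factorial)| ≤ C * (|z| * r) ^ (n + 1) := by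
      intro n
      rcases eq_or_ne z 0 with rfl | hz0
      · rw [Finset.sum_range_succ']
        simp
      · obtain ⟨y, -, hy⟩ := taylor_mean_remainder_lagrange_iteratedDeriv (f := f) (x₀ := x)
          (x := x + z) (n := n) (by simpa using hz0)
          ((hf.of_le (by exact_mod_cast le_top)).contDiffOn)
        have hT : taylorWithinEval f n (uIcc x (x + z)) x (x + z) =
            ∑ k ∈ Finset.range (n + 1), z ^ k * (iteratedDeriv k f x / k.factorial) := by
          rw [taylor_within_apply]
          refine Finset.sum_congr rfl fun k _ => ?_
          have hu : UniqueDiffOn ℝ (uIcc x (x + z)) :=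
            uniqueDiffOn_Icc (by simpa using hz0)
          rw [iteratedDerivWithin_eq_iteratedDeriv hu
            ((hf.of_le (by exact_mod_cast le_top)).contDiffAt) left_mem_uIcc]
          simp only [add_sub_cancel_left, smul_eq_mul]
          ring
        rw [hT] at hy
        rw [hy, add_sub_cancel_left]
        have hn : (0 : ℝ) < (n + 1).factorial := by exact_mod_cast (n + 1).factorial_pos
        rw [abs_div, abs_mul, abs_of_pos hn, div_le_iff₀ hn, abs_pow]
        calc _ ≤ (C * r ^ (n + 1) * (n + 1).factorial) * |z| ^ (n + 1) := by
              gcongr; exact h (n + 1) y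
          _ = _ := by rw [mul_pow]; ring
    rw [tendsto_iff_norm_sub_tendsto_zero]
    refine squeeze_zero (fun _ => norm_nonneg _) (fun n => ?_) (g := fun n => C * (|z| * r) ^ (n + 1)) ?_
    · rw [norm_sub_rev]; exact hrem n
    · have := (tendsto_pow_atTop_nhds_zero_of_lt_one hzr hz).const_mul C
      rw [mul_zero] at this
      exact (Filter.tendsto_add_atTop_iff_nat 1).2 this
  simpa [FormalMultilinearSeries.coeff_ofScalars, smul_eq_mul] using hgoal

theorem AnalyticAt.hasDerivAt_along_line {G : ℝ → ℝ → ℝ} {t x c : ℝ}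
    (h : AnalyticAt ℝ (Function.uncurry G) (t, x + t * c)) :
    HasDerivAt (fun s => G s (x + s * c))
      (_root_.timeDeriv G t (x + t * c) + c * _root_.spaceDeriv G t (x + t * c)) t := by
  have h1 : HasDerivAt (fun s : ℝ => (s, x + s * c)) ((1 : ℝ), c) t := by
    refine (hasDerivAt_id t).prodMk ?_
    simpa using ((hasDerivAt_id t).mul_const c).const_add x
  have h2 := h.differentiableAt.hasFDerivAt.comp_hasDerivAt t h1
  have h3 : ((1 : ℝ), c) = (1, 0) + c • ((0 : ℝ), (1 : ℝ)) := by simp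
  rw [h3, map_add, map_smul, smul_eq_mul,
    ← (hasDerivAt_time_fderiv h.differentiableAt).deriv,
    ← (hasDerivAt_space_fderiv h.differentiableAt).deriv] at h2
  exact h2

/-! ### Characteristics: the solution and its analyticity -/

/-- The position at time `t` of the characteristic of the Burgers equation starting at `x`. -/
def flowMap (f : ℝ → ℝ) (t x : ℝ) : ℝ := x + t * f x

/-- The solution of the Burgers equation with initial value `f`, constant along characteristics. -/
noncomputable def burgersSol (f : ℝ → ℝ) (t y : ℝ) : ℝ := f (Function.invFun (flowMap f t) y)

section Characteristics

variable {f : ℝ → ℝ} {L B : ℝ} {t : ℝ}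

theorem abs_mul_le_of_deriv_bound (hL : ∀ x, |deriv f x| ≤ L) (x : ℝ) :
    |t * deriv f x| ≤ |t| * L := by
  rw [abs_mul]
  exact mul_le_mul_of_nonneg_left (hL x) (abs_nonneg t)

theorem one_add_mul_deriv_pos (hL : ∀ x, |deriv f x| ≤ L) (ht : |t| * L < 1) (x : ℝ) :
    0 < 1 + t * deriv f x := by
  have := (abs_le.1 (abs_mul_le_of_deriv_bound (t := t) hL x)).1
  linarith

theorem hasDerivAt_flowMap (hf : Differentiable ℝ f) (x : ℝ) :
    HasDerivAt (flowMap f t) (1 + t * deriv f x) x :=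
  (hasDerivAt_id x).add ((hf x).hasDerivAt.const_mul t)

theorem flowMap_injective (hf : Differentiable ℝ f) (hL : ∀ x, |deriv f x| ≤ L)
    (ht : |t| * L < 1) : Function.Injective (flowMap f t) := by
  refine (strictMono_of_deriv_pos fun x => ?_).injective
  rw [(hasDerivAt_flowMap hf x).deriv]
  exact one_add_mul_deriv_pos hL ht x

theorem flowMap_surjective (hf : Differentiable ℝ f) (hB : ∀ x, |f x| ≤ B) :
    Function.Surjective (flowMap f t) := by
  have hb : ∀ x, |t * f x| ≤ |t| * B := fun x => by
    rw [abs_mul]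
    exact mul_le_mul_of_nonneg_left (hB x) (abs_nonneg t)
  have hc : Continuous (flowMap f t) :=
    continuous_id.add (continuous_const.mul hf.continuous)
  refine hc.surjective ?_ ?_
  · refine Filter.tendsto_atTop_mono (f := fun x => x - |t| * B) (fun x => ?_) ?_
    · have := (abs_le.1 (hb x)).1
      simp only [flowMap]
      linarith
    · exact Filter.tendsto_atTop_add_const_right _ _ Filter.tendsto_id
  · refine Filter.tendsto_atBot_mono (f := fun x => x + |t| * B) (fun x => ?_) ?_
    · have := (abs_le.1 (hb x)).2
      simp only [flowMap]
      linarith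
    · exact Filter.tendsto_atBot_add_const_right _ _ Filter.tendsto_id

theorem burgersSol_flowMap (hf : Differentiable ℝ f) (hL : ∀ x, |deriv f x| ≤ L)
    (ht : |t| * L < 1) (x : ℝ) : burgersSol f t (flowMap f t x) = f x := by
  rw [burgersSol, Function.leftInverse_invFun (flowMap_injective hf hL ht)]

theorem burgersSol_zero (f : ℝ → ℝ) : burgersSol f 0 = f := by
  have h : flowMap f 0 = id := by
    ext x
    simp [flowMap]
  ext x
  rw [burgersSol, h]
  congr 1
  exact Function.leftInverse_invFun Function.injective_id x

/-- The space-time map (t, x) ↦ (t, x + t f(x)) is analytic with triangular derivative of diagonal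
entries 1 and J ≠ 0, so it has an analytic local inverse g; near the point, the solution is f
applied to the space component of g. -/
theorem analyticAt_burgersSol (hfa : ∀ x, AnalyticAt ℝ f x) (hL : ∀ x, |deriv f x| ≤ L)
    (hB : ∀ x, |f x| ≤ B) (ht : |t| * L < 1) (y : ℝ) :
    AnalyticAt ℝ (Function.uncurry (burgersSol f)) (t, y) := by
  have hf : Differentiable ℝ f := fun x => (hfa x).differentiableAt
  obtain ⟨x, rfl⟩ := flowMap_surjective (t := t) hf hB y
  set J := 1 + t * deriv f x with hJ
  have hJ0 : J ≠ 0 := (one_add_mul_deriv_pos hL ht x).ne'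
  let Φ : ℝ × ℝ → ℝ × ℝ := fun p => (p.1, flowMap f p.1 p.2)
  have hfsnd : AnalyticAt ℝ (fun p : ℝ × ℝ => f p.2) (t, x) :=
    AnalyticAt.fun_comp (g := f) (f := fun p : ℝ × ℝ => p.2) (hfa x) analyticAt_snd
  have hΦa : AnalyticAt ℝ Φ (t, x) :=
    analyticAt_fst.prod (analyticAt_snd.add (analyticAt_fst.mul hfsnd))
  let e : (ℝ × ℝ) ≃L[ℝ] (ℝ × ℝ) := ContinuousLinearEquiv.equivOfInverse
    ((ContinuousLinearMap.fst ℝ ℝ ℝ).prod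
      (f x • ContinuousLinearMap.fst ℝ ℝ ℝ + J • ContinuousLinearMap.snd ℝ ℝ ℝ))
    ((ContinuousLinearMap.fst ℝ ℝ ℝ).prod
      (-(J⁻¹ * f x) • ContinuousLinearMap.fst ℝ ℝ ℝ + J⁻¹ • ContinuousLinearMap.snd ℝ ℝ ℝ))
    (fun p => by
      ext
      · simp
      · simp
        field_simp
        ring)
    (fun p => by
      ext
      · simp
      · simp
        field_simp
        ring)
  have hΦd : HasFDerivAt Φ (e : (ℝ × ℝ) →L[ℝ] (ℝ × ℝ)) (t, x) := by
    have h1 : HasFDerivAt (fun p : ℝ × ℝ => f p.2)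
        (deriv f x • ContinuousLinearMap.snd ℝ ℝ ℝ) (t, x) :=
      (hf x).hasDerivAt.comp_hasFDerivAt (t, x) hasFDerivAt_snd
    have h2 : HasFDerivAt (fun p : ℝ × ℝ => p.2 + p.1 * f p.2) _ (t, x) :=
      hasFDerivAt_snd.add (hasFDerivAt_fst.mul h1)
    refine (hasFDerivAt_fst.prodMk h2).congr_fderiv ?_
    ext <;> simp [e, hJ]
  have hΦc : ContDiffAt ℝ ω Φ (t, x) := hΦa.contDiffAt
  set g := hΦc.localInverse hΦd (by simp) with hg
  have hga : AnalyticAt ℝ g (Φ (t, x)) := (hΦc.to_localInverse hΦd (by simp)).analyticAt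
  have hgv : g (Φ (t, x)) = (t, x) := hΦc.localInverse_apply_image hΦd (by simp)
  have hright : ∀ᶠ q in nhds (Φ (t, x)), Φ (g q) = q :=
    (hΦc.hasStrictFDerivAt' hΦd (by simp)).eventually_right_inverse
  have hstrip : ∀ᶠ q : ℝ × ℝ in nhds (Φ (t, x)), |q.1| * L < 1 := by
    have : ContinuousAt (fun q : ℝ × ℝ => |q.1| * L) (Φ (t, x)) := by fun_prop
    exact this.eventually_lt_const ht
  have hcomp : AnalyticAt ℝ (fun q => f (g q).2) (Φ (t, x)) := by
    refine AnalyticAt.fun_comp (g := f) (f := fun q => (g q).2) (hfa _) ?_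
    exact AnalyticAt.fun_comp (g := Prod.snd) analyticAt_snd hga
  refine hcomp.congr ?_
  -- The map Φ preserves time, so g(q) carries the time of q; injectivity of the flow at that nearby
  -- time identifies its space component with the one chosen by `Function.invFun`.
  filter_upwards [hright, hstrip] with q hq hq1
  have h1 : (Φ (g q)).1 = q.1 := congrArg Prod.fst hq
  have h2 : (Φ (g q)).2 = q.2 := congrArg Prod.snd hq
  change (g q).1 = q.1 at h1
  change flowMap f (g q).1 (g q).2 = q.2 at h2
  rw [h1] at h2
  rw [Function.uncurry_def]
  simp only
  rw [← h2, burgersSol_flowMap hf hL hq1]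

/-- Differentiate in s the constancy of the solution along s ↦ x + s f(x). -/
theorem timeDeriv_burgersSol (hfa : ∀ x, AnalyticAt ℝ f x) (hL : ∀ x, |deriv f x| ≤ L)
    (hB : ∀ x, |f x| ≤ B) (ht : |t| * L < 1) (y : ℝ) :
    timeDeriv (burgersSol f) t y = -(burgersSol f t y * spaceDeriv (burgersSol f) t y) := by
  have hf : Differentiable ℝ f := fun x => (hfa x).differentiableAt
  obtain ⟨x, rfl⟩ := flowMap_surjective (t := t) hf hB y
  have h1 := (analyticAt_burgersSol hfa hL hB ht (flowMap f t x)).hasDerivAt_along_line (c := f x)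
  have hstrip : ∀ᶠ s : ℝ in nhds t, |s| * L < 1 := by
    have : ContinuousAt (fun s : ℝ => |s| * L) t := by fun_prop
    exact this.eventually_lt_const ht
  have h2 : HasDerivAt (fun s => burgersSol f s (x + s * f x)) 0 t := by
    refine (hasDerivAt_const t (f x)).congr_of_eventuallyEq ?_
    filter_upwards [hstrip] with s hs using burgersSol_flowMap hf hL hs x
  have h3 := h1.unique h2
  change timeDeriv (burgersSol f) t (flowMap f t x) + f x * spaceDeriv (burgersSol f) t (flowMap f t x) = 0 at h3
  rw [burgersSol_flowMap hf hL ht]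
  linarith

theorem isBurgersSolution_burgersSol {T : ℝ} (hfa : ∀ x, AnalyticAt ℝ f x)
    (hL : ∀ x, |deriv f x| ≤ L) (hB : ∀ x, |f x| ≤ B) (hT : ∀ t ∈ Icc 0 T, |t| * L < 1) :
    IsBurgersSolution T (burgersSol f) where
  contDiffOn := fun p hp =>
    (analyticAt_burgersSol hfa hL hB (hT p.1 hp.1) p.2).contDiffAt.contDiffWithinAt
  equation := fun t ht x => by
    have h := (analyticAt_burgersSol hfa hL hB (hT t ht) x).hasDerivAt_time
    rw [timeDeriv_burgersSol hfa hL hB (hT t ht)] at h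
    exact h.hasDerivWithinAt

end Characteristics

/-- A `C¹` solution of the Burgers equation is constant along the characteristics of its initial
value. -/
theorem IsBurgersSolution.apply_flowMap {T : ℝ} (hT : 0 < T) {v : ℝ → ℝ → ℝ}
    (hv : IsBurgersSolution T v) {t : ℝ} (ht : t ∈ Icc 0 T) (x : ℝ) :
    v t (flowMap (v 0) t x) = v 0 x := by
  set S : Set (ℝ × ℝ) := Icc 0 T ×ˢ univ with hS
  set c := v 0 x with hc
  have hu : UniqueDiffOn ℝ S := (uniqueDiffOn_Icc hT).prod uniqueDiffOn_univ
  let D : ℝ × ℝ → (ℝ × ℝ) →L[ℝ] ℝ := fderivWithin ℝ (Function.uncurry v) S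
  have hD : ∀ s ∈ Icc 0 T, ∀ y, HasFDerivWithinAt (Function.uncurry v) (D (s, y)) S (s, y) :=
    fun s hs y => (hv.contDiffOn.differentiableOn one_ne_zero (s, y)
      ⟨hs, mem_univ _⟩).hasFDerivWithinAt
  have hDc : ContinuousOn D S := hv.contDiffOn.continuousOn_fderivWithin hu le_rfl
  have hspace : ∀ s ∈ Icc 0 T, ∀ y, deriv (v s) y = D (s, y) (0, 1) := by
    intro s hs y
    have h1 : HasDerivWithinAt (fun y : ℝ => (s, y)) ((0 : ℝ), (1 : ℝ)) univ y :=
      ((hasDerivAt_const y s).prodMk (hasDerivAt_id y)).hasDerivWithinAt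
    have hm : MapsTo (fun y : ℝ => (s, y)) univ S := fun z _ => ⟨hs, mem_univ _⟩
    exact (hasDerivWithinAt_univ.1 ((hD s hs y).comp_hasDerivWithinAt y h1 hm)).deriv
  have htime : ∀ s ∈ Icc 0 T, ∀ y, D (s, y) (1, 0) = -(v s y * D (s, y) (0, 1)) := by
    intro s hs y
    have h1 : HasDerivWithinAt (fun s : ℝ => (s, y)) ((1 : ℝ), (0 : ℝ)) (Icc 0 T) s :=
      ((hasDerivAt_id s).prodMk (hasDerivAt_const s y)).hasDerivWithinAt
    have hm : MapsTo (fun s : ℝ => (s, y)) (Icc 0 T) S := fun z hz => ⟨hz, mem_univ _⟩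
    have h2 := (hD s hs y).comp_hasDerivWithinAt s h1 hm
    have h3 := hv.equation s hs y
    rw [hspace s hs y] at h3
    exact (uniqueDiffOn_Icc hT s hs).eq_deriv _ h2 h3
  -- Along the straight line of slope c = v(0, x), the defect h satisfies the linear equation h' =
  -- -h vₓ with h(0) = 0. A bound for vₓ on this compact segment suffices for Gronwall; no global
  -- bound on v is needed.
  let h : ℝ → ℝ := fun s => v s (x + s * c) - c
  have hder : ∀ s ∈ Icc 0 T,
      HasDerivWithinAt h (-(h s * D (s, x + s * c) (0, 1))) (Icc 0 T) s := by
    intro s hs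
    have h1 : HasDerivWithinAt (fun s : ℝ => (s, x + s * c)) ((1 : ℝ), c) (Icc 0 T) s := by
      refine ((hasDerivAt_id s).prodMk ?_).hasDerivWithinAt
      simpa using ((hasDerivAt_id s).mul_const c).const_add x
    have hm : MapsTo (fun s : ℝ => (s, x + s * c)) (Icc 0 T) S := fun z hz => ⟨hz, mem_univ _⟩
    have h2 := (hD s hs (x + s * c)).comp_hasDerivWithinAt s h1 hm
    have h3 : ((1 : ℝ), c) = (1, 0) + c • ((0 : ℝ), (1 : ℝ)) := by simp
    rw [h3, map_add, map_smul, smul_eq_mul, htime s hs] at h2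
    refine (h2.sub_const c).congr_deriv ?_
    simp only [h]
    ring
  have hcurve : ContinuousOn (fun s : ℝ => D (s, x + s * c)) (Icc 0 T) :=
    hDc.comp (f := fun s : ℝ => (s, x + s * c)) (by fun_prop) fun s hs => ⟨hs, mem_univ _⟩
  obtain ⟨K, hK⟩ := isCompact_Icc.exists_bound_of_continuousOn hcurve
  have hbound := norm_le_gronwallBound_of_norm_deriv_right_le (f := h)
    (f' := fun s => -(h s * D (s, x + s * c) (0, 1))) (δ := 0) (K := K) (ε := 0) (a := 0) (b := T)
    (fun s hs => (hder s hs).continuousWithinAt)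
    (fun s hs => (hder s (Ico_subset_Icc_self hs)).mono_of_mem_nhdsWithin
      (Icc_mem_nhdsGE_of_mem hs))
    (by simp [h, hc])
    (fun s hs => by
      have h1 := (D (s, x + s * c)).le_opNorm (0, 1)
      have h2 := hK s (Ico_subset_Icc_self hs)
      rw [norm_neg, norm_mul, add_zero, mul_comm]
      refine mul_le_mul_of_nonneg_right (h1.trans ?_) (norm_nonneg _)
      simpa [Prod.norm_def] using h2) t ht
  rw [gronwallBound_ε0_δ0, norm_le_zero_iff] at hbound
  exact sub_eq_zero.1 hbound

/-! ### Evolution of the space derivatives along characteristics -/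

/-- The `n`-th space derivative of the solution of the Burgers equation with initial value `f`, in
Lagrangian coordinates. -/
noncomputable def lagDeriv (f : ℝ → ℝ) (n : ℕ) (t x : ℝ) : ℝ :=
  (spaceDeriv^[n] (burgersSol f)) t (flowMap f t x)

/-- The part of the source term for `lagDeriv f n` which involves only derivatives of orders from
`2` to `n - 1`. -/
noncomputable def lagSource (f : ℝ → ℝ) (n : ℕ) (t x : ℝ) : ℝ :=
  ∑ j ∈ Finset.Ico 2 n, (n.choose j : ℝ) * (lagDeriv f j t x * lagDeriv f (n + 1 - j) t x)

theorem lagDeriv_zero_time (f : ℝ → ℝ) (n : ℕ) : lagDeriv f n 0 = iteratedDeriv n f := by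
  ext x
  rw [lagDeriv, ← iteratedDeriv_eq_spaceDeriv_iterate, burgersSol_zero]
  simp [flowMap]

section Lagrangian

variable {f : ℝ → ℝ} {L B t : ℝ}

theorem lagDeriv_zero (hf : Differentiable ℝ f) (hL : ∀ x, |deriv f x| ≤ L) (ht : |t| * L < 1) :
    lagDeriv f 0 t = f :=
  funext fun x => burgersSol_flowMap hf hL ht x

variable (hfa : ∀ x, AnalyticAt ℝ f x) (hL : ∀ x, |deriv f x| ≤ L) (hB : ∀ x, |f x| ≤ B)
  (ht : |t| * L < 1)

include hfa hL hB ht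

theorem analyticAt_lagDeriv (n : ℕ) (x : ℝ) :
    AnalyticAt ℝ (Function.uncurry (lagDeriv f n)) (t, x) := by
  have hfsnd : AnalyticAt ℝ (fun p : ℝ × ℝ => f p.2) (t, x) :=
    AnalyticAt.fun_comp (g := f) (f := fun p : ℝ × ℝ => p.2) (hfa x) analyticAt_snd
  have h2 : AnalyticAt ℝ (fun p : ℝ × ℝ => (p.1, flowMap f p.1 p.2)) (t, x) :=
    analyticAt_fst.prod (analyticAt_snd.add (analyticAt_fst.mul hfsnd))
  exact AnalyticAt.fun_comp (g := Function.uncurry (spaceDeriv^[n] (burgersSol f)))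
    (f := fun p : ℝ × ℝ => (p.1, flowMap f p.1 p.2))
    ((analyticAt_burgersSol hfa hL hB ht _).spaceDeriv_iterate n) h2

theorem continuous_lagDeriv (n : ℕ) : Continuous (lagDeriv f n t) :=
  (contDiff_space (n := 0) fun x => analyticAt_lagDeriv hfa hL hB ht n x).continuous

theorem hasDerivAt_lagDeriv_space (n : ℕ) (x : ℝ) :
    HasDerivAt (lagDeriv f n t) (lagDeriv f (n + 1) t x * (1 + t * deriv f x)) x := by
  have h := (((analyticAt_burgersSol hfa hL hB ht (flowMap f t x)).spaceDeriv_iterate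
    n).hasDerivAt_space).comp x (hasDerivAt_flowMap (fun x => (hfa x).differentiableAt) x)
  refine h.congr_deriv ?_
  rw [lagDeriv, Function.iterate_succ_apply']

theorem timeDeriv_spaceDeriv_burgersSol (n : ℕ) (y : ℝ) :
    timeDeriv (spaceDeriv^[n] (burgersSol f)) t y =
      -∑ j ∈ Finset.range (n + 1), (n.choose j : ℝ) * ((spaceDeriv^[j] (burgersSol f)) t y *
        (spaceDeriv^[n + 1 - j] (burgersSol f)) t y) := by
  have ha := fun y => analyticAt_burgersSol hfa hL hB ht y
  rw [timeDeriv_spaceDeriv_iterate ha, ← iteratedDeriv_eq_spaceDeriv_iterate]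
  have h1 : timeDeriv (burgersSol f) t =
      fun y => -(burgersSol f t y * spaceDeriv (burgersSol f) t y) :=
    funext fun y => timeDeriv_burgersSol hfa hL hB ht y
  rw [h1, iteratedDeriv_fun_neg, iteratedDeriv_fun_mul (contDiff_space ha).contDiffAt
    (contDiff_space fun x => (ha x).spaceDeriv).contDiffAt]
  congr 1
  refine Finset.sum_congr rfl fun j hj => ?_
  have hj' : n + 1 - j = (n - j) + 1 := by
    have := Finset.mem_range.1 hj
    omega
  rw [iteratedDeriv_eq_spaceDeriv_iterate, iteratedDeriv_eq_spaceDeriv_iterate, hj',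
    Function.iterate_succ_apply, mul_assoc]

/-- The j = 0 term of the Leibniz sum is u ∂ₓ^(n+1) u, which the transport term f(x) ∂ₓ^(n+1) u
along the characteristic cancels exactly. -/
theorem hasDerivAt_lagDeriv_time (n : ℕ) (x : ℝ) :
    HasDerivAt (fun s => lagDeriv f n s x)
      (-∑ j ∈ Finset.Ico 1 (n + 1), (n.choose j : ℝ) *
        (lagDeriv f j t x * lagDeriv f (n + 1 - j) t x)) t := by
  have ha := analyticAt_burgersSol hfa hL hB ht (flowMap f t x)
  have h := (ha.spaceDeriv_iterate n).hasDerivAt_along_line (c := f x)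
  refine h.congr_deriv ?_
  change timeDeriv (spaceDeriv^[n] (burgersSol f)) t (flowMap f t x) +
    f x * spaceDeriv (spaceDeriv^[n] (burgersSol f)) t (flowMap f t x) = _
  rw [timeDeriv_spaceDeriv_burgersSol hfa hL hB ht, Finset.range_eq_Ico,
    Finset.sum_eq_sum_Ico_succ_bot (Nat.succ_pos n), ← Function.iterate_succ_apply' spaceDeriv n]
  have h0 : (spaceDeriv^[0] (burgersSol f)) t (flowMap f t x) = f x :=
    burgersSol_flowMap (fun x => (hfa x).differentiableAt) hL ht x
  rw [h0]
  simp only [lagDeriv, Nat.choose_zero_right, Nat.cast_one, Nat.sub_zero, zero_add]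
  ring

theorem lagDeriv_one_mul (x : ℝ) : lagDeriv f 1 t x * (1 + t * deriv f x) = deriv f x := by
  have h := (hasDerivAt_lagDeriv_space hfa hL hB ht 0 x).deriv
  rw [lagDeriv_zero (fun x => (hfa x).differentiableAt) hL ht] at h
  exact h.symm

/-- For n = 2 the source is empty, so J³ w_2 is conserved. The identity is obtained by
differentiating J w_1 = f' in x. -/
theorem lagDeriv_two_mul (x : ℝ) :
    lagDeriv f 2 t x * (1 + t * deriv f x) ^ 3 = iteratedDeriv 2 f x := by
  have hJ : ∀ x, 1 + t * deriv f x ≠ 0 := fun x => (one_add_mul_deriv_pos hL ht x).ne'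
  have h1 : HasDerivAt (deriv f) (iteratedDeriv 2 f x) x := by
    rw [iteratedDeriv_succ, iteratedDeriv_one]
    exact (hfa x).deriv.differentiableAt.hasDerivAt
  have h2 : HasDerivAt (fun x => 1 + t * deriv f x) (t * iteratedDeriv 2 f x) x :=
    (h1.const_mul t).const_add 1
  have h3 := (hasDerivAt_lagDeriv_space hfa hL hB ht 1 x).mul h2
  have h4 : lagDeriv f 1 t * (fun x => 1 + t * deriv f x) = deriv f :=
    funext fun x => lagDeriv_one_mul hfa hL hB ht x
  rw [h4] at h3
  have h5 := h3.unique h1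
  have h6 := lagDeriv_one_mul hfa hL hB ht x
  norm_num at h5
  set J := 1 + t * deriv f x with hJd
  have h7 : 1 - t * lagDeriv f 1 t x = 1 / J := by
    rw [eq_div_iff (hJ x)]
    linear_combination (-t) * h6 + hJd
  have h8 : lagDeriv f 2 t x * J * J = iteratedDeriv 2 f x * (1 - t * lagDeriv f 1 t x) := by
    linear_combination h5
  rw [h7] at h8
  have h9 : 1 / J * J = 1 := one_div_mul_cancel (hJ x)
  linear_combination J * h8 + iteratedDeriv 2 f x * h9

/-- The terms j = 1 and j = n of the evolution equation give (n + 1) w_1 w_n, and J w_1 = f' is the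
time derivative of J, so J^(n+1) is an integrating factor. The constant c serves to normalise the
weight to 1 at a chosen final time. -/
theorem hasDerivAt_pow_mul_lagDeriv {n : ℕ} (hn : 2 ≤ n) (x c : ℝ) :
    HasDerivAt (fun s => ((1 + s * deriv f x) / c) ^ (n + 1) * lagDeriv f n s x)
      (-(((1 + t * deriv f x) / c) ^ (n + 1) * lagSource f n t x)) t := by
  have h1 : HasDerivAt (fun s : ℝ => (1 + s * deriv f x) / c) (deriv f x / c) t := by
    simpa using (((hasDerivAt_id t).mul_const (deriv f x)).const_add 1).div_const c
  have h2 := (h1.pow (n + 1)).mul (hasDerivAt_lagDeriv_time hfa hL hB ht n x)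
  refine h2.congr_deriv ?_
  have h3 : ∑ j ∈ Finset.Ico 1 (n + 1), (n.choose j : ℝ) *
        (lagDeriv f j t x * lagDeriv f (n + 1 - j) t x) =
      (n + 1) * (lagDeriv f 1 t x * lagDeriv f n t x) + lagSource f n t x := by
    rw [Finset.sum_eq_sum_Ico_succ_bot (by omega), Finset.sum_Ico_succ_top (by omega), lagSource]
    simp only [Nat.choose_one_right, Nat.add_sub_cancel, Nat.choose_self, Nat.cast_one,
      Nat.add_sub_cancel_left]
    ring
  rw [h3]
  have h4 := lagDeriv_one_mul hfa hL hB ht x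
  simp only [Nat.add_sub_cancel, Pi.pow_apply, Nat.cast_add, Nat.cast_one, pow_succ]
  linear_combination (-(n + 1) * ((1 + t * deriv f x) / c) ^ n / c * lagDeriv f n t x) * h4

end Lagrangian

/-! ### L² estimates for the derivatives by induction on the order -/

section Energy

variable {f : ℝ → ℝ} {L B T K γ : ℝ} {A : ℕ → ℝ}

theorem one_add_mul_deriv_mem_Icc (hL : ∀ x, |deriv f x| ≤ L) {t : ℝ} (ht : |t| * L ≤ 1 / 2)
    (x : ℝ) : 1 + t * deriv f x ∈ Icc (1 / 2 : ℝ) (3 / 2) := by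
  have := abs_le.1 (abs_mul_le_of_deriv_bound (t := t) hL x)
  constructor <;> linarith [this.1, this.2]

/-- The quotient is 1 - (t - s) f' / J_t with J_t ≥ 1/2, hence at most 1 + 2 L (t - s). -/
theorem one_add_mul_deriv_div_le_exp (hL : ∀ x, |deriv f x| ≤ L) {s t : ℝ}
    (ht : |t| * L ≤ 1 / 2) (hst : s ≤ t) (x : ℝ) :
    (1 + s * deriv f x) / (1 + t * deriv f x) ≤ Real.exp (2 * L * (t - s)) := by
  have hJ := (one_add_mul_deriv_mem_Icc hL ht x).1
  have h0 : 0 < 1 + t * deriv f x := by linarith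
  have hd := abs_le.1 (hL x)
  refine le_trans ?_ (Real.add_one_le_exp _)
  rw [div_le_iff₀ h0]
  have hts : 0 ≤ t - s := sub_nonneg.2 hst
  have hL0 : 0 ≤ L := (abs_nonneg _).trans (hL x)
  have h1 : L * (t - s) ≤ 2 * L * (t - s) * (1 + t * deriv f x) := by
    have : 0 ≤ L * (t - s) := mul_nonneg hL0 hts
    nlinarith
  have h2 : -(deriv f x) * (t - s) ≤ L * (t - s) :=
    mul_le_mul_of_nonneg_right (by linarith [hd.1]) hts
  nlinarith

/-- A pointwise bound for a Lagrangian derivative from `L²` bounds. -/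
theorem abs_lagDeriv_le (hfa : ∀ x, AnalyticAt ℝ f x) (hL : ∀ x, |deriv f x| ≤ L)
    (hB : ∀ x, |f x| ≤ B) {t : ℝ} (ht : |t| * L ≤ 1 / 2) {p : ℕ} {a b : ℝ} (ha : 0 ≤ a)
    (hb : 0 ≤ b) (h0 : eLpNorm (lagDeriv f p t) 2 volume ≤ ENNReal.ofReal a)
    (h1 : eLpNorm (lagDeriv f (p + 1) t) 2 volume ≤ ENNReal.ofReal b) (x : ℝ) :
    |lagDeriv f p t x| ≤ a + 2 * b := by
  have ht' : |t| * L < 1 := by linarith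
  have hd : Continuous (deriv f) :=
    continuous_iff_continuousAt.2 fun x => (hfa x).deriv.continuousAt
  have h2 := enorm_le_eLpNorm_add_eLpNorm_deriv
    (hasDerivAt_lagDeriv_space hfa hL hB ht' p)
    ((continuous_lagDeriv hfa hL hB ht' (p + 1)).mul (by fun_prop)) x
  have h3 : eLpNorm (fun x => lagDeriv f (p + 1) t x * (1 + t * deriv f x)) 2 volume ≤
      ENNReal.ofReal 2 * ENNReal.ofReal b := by
    refine (eLpNorm_le_ofReal_mul (g := lagDeriv f (p + 1) t) fun x => ?_).trans
      (mul_le_mul' le_rfl h1)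
    have hJ := one_add_mul_deriv_mem_Icc hL ht x
    rw [abs_mul, mul_comm]
    refine mul_le_mul_of_nonneg_right ?_ (abs_nonneg _)
    rw [abs_of_nonneg (by linarith [hJ.1])]
    linarith [hJ.2]
  have h4 : ‖lagDeriv f p t x‖ₑ ≤ ENNReal.ofReal (a + 2 * b) := by
    rw [ENNReal.ofReal_add ha (by positivity), ENNReal.ofReal_mul (by norm_num)]
    exact h2.trans (add_le_add h0 h3)
  rw [Real.enorm_eq_ofReal_abs] at h4
  exact (ENNReal.ofReal_le_ofReal_iff (by positivity)).1 h4

/-- The factor 8 comes from J³ ≥ (1/2)³; it is what the reserve A n / 8 on the initial data pays for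
at order 2. -/
theorem abs_lagDeriv_two_le (hfa : ∀ x, AnalyticAt ℝ f x) (hL : ∀ x, |deriv f x| ≤ L)
    (hB : ∀ x, |f x| ≤ B) {t : ℝ} (ht : |t| * L ≤ 1 / 2) (x : ℝ) :
    |lagDeriv f 2 t x| ≤ 8 * |iteratedDeriv 2 f x| := by
  have hJ := (one_add_mul_deriv_mem_Icc hL ht x).1
  have h := lagDeriv_two_mul hfa hL hB (by linarith) x
  have hJ3 : (1 / 8 : ℝ) ≤ (1 + t * deriv f x) ^ 3 := by
    calc (1 / 8 : ℝ) = (1 / 2) ^ 3 := by norm_num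
      _ ≤ _ := pow_le_pow_left₀ (by norm_num) hJ 3
  rw [← h, abs_mul, abs_of_nonneg (by linarith : (0 : ℝ) ≤ (1 + t * deriv f x) ^ 3)]
  nlinarith [abs_nonneg (lagDeriv f 2 t x)]

theorem abs_lagDeriv_one_le (hfa : ∀ x, AnalyticAt ℝ f x) (hL : ∀ x, |deriv f x| ≤ L)
    (hB : ∀ x, |f x| ≤ B) {t : ℝ} (ht : |t| * L ≤ 1 / 2) (x : ℝ) :
    |lagDeriv f 1 t x| ≤ 2 * |deriv f x| := by
  have hJ := (one_add_mul_deriv_mem_Icc hL ht x).1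
  have h := lagDeriv_one_mul hfa hL hB (by linarith) x
  have h2 : |deriv f x| = |lagDeriv f 1 t x| * (1 + t * deriv f x) := by
    nth_rewrite 1 [← h]
    rw [abs_mul, abs_of_nonneg (by linarith : (0 : ℝ) ≤ 1 + t * deriv f x)]
  nlinarith [abs_nonneg (lagDeriv f 1 t x)]

/-- The Lagrangian derivatives of the solution of the Burgers equation grow in `L²` at most
geometrically in their order. -/
theorem eLpNorm_lagDeriv_le (hfa : ∀ x, AnalyticAt ℝ f x) (hL : ∀ x, |deriv f x| ≤ L)
    (hB : ∀ x, |f x| ≤ B) (hT : T * L ≤ 1 / 2) (hA0 : ∀ n, 0 ≤ A n)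
    (hE : ∀ n, eLpNorm (iteratedDeriv n f) 2 volume ≤ ENNReal.ofReal (A n / 8))
    (hA : ∀ n, 3 ≤ n → ∑ j ∈ Finset.Ico 2 n, (n.choose j : ℝ) *
      ((A (min j (n + 1 - j)) + 2 * A (min j (n + 1 - j) + 1)) * A (max j (n + 1 - j))) ≤
        K * (n - 2) * A n)
    (hK : 0 ≤ K) (hγ : 8 * L + 2 * K ≤ γ) {n : ℕ} (hn : 2 ≤ n) :
    ∀ t ∈ Icc 0 T, eLpNorm (lagDeriv f n t) 2 volume ≤
      ENNReal.ofReal (A n * Real.exp (γ * (n - 2) * t)) := by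
  have hL0 : 0 ≤ L := (abs_nonneg _).trans (hL 0)
  have hγ0 : 0 ≤ γ := by linarith
  have htL : ∀ t ∈ Icc 0 T, |t| * L ≤ 1 / 2 := fun t ht => by
    rw [abs_of_nonneg ht.1]
    exact (mul_le_mul_of_nonneg_right ht.2 hL0).trans hT
  have htL' : ∀ t ∈ Icc 0 T, |t| * L < 1 := fun t ht => by linarith [htL t ht]
  have hfs : ContDiff ℝ ω f := contDiff_iff_contDiffAt.2 fun x => (hfa x).contDiffAt
  have hdc : Continuous (deriv f) :=
    continuous_iff_continuousAt.2 fun x => (hfa x).deriv.continuousAt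
  induction n using Nat.strong_induction_on with
  | _ n ih =>
    rcases eq_or_lt_of_le hn with rfl | hn3
    · intro t ht
      refine (eLpNorm_le_ofReal_mul (abs_lagDeriv_two_le hfa hL hB (htL t ht))).trans ?_
      refine (mul_le_mul' le_rfl (hE 2)).trans ?_
      rw [← ENNReal.ofReal_mul (by norm_num)]
      refine ENNReal.ofReal_le_ofReal ?_
      norm_num
      linarith
    · have hnr : (3 : ℝ) ≤ n := by exact_mod_cast hn3
      -- pointwise bounds for the factors of lower order
      have hsup : ∀ p, 2 ≤ p → 2 * p ≤ n + 1 → ∀ t ∈ Icc 0 T, ∀ x,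
          |lagDeriv f p t x| ≤ (A p + 2 * A (p + 1)) * Real.exp (γ * (p - 1) * t) := by
        intro p hp hpn t ht x
        have hpr : (2 : ℝ) ≤ p := by exact_mod_cast hp
        have ht0 := ht.1
        -- A sup bound at order p needs L² bounds at p and p + 1. For p = 2 and n = 3 the order p +
        -- 1 is n itself, outside the induction hypothesis, so order 2 is read off from the explicit
        -- formula and the initial data; for p ≥ 3, 2 p ≤ n + 1 forces p + 1 < n.
        rcases eq_or_lt_of_le hp with rfl | hp3
        · have h1 := enorm_le_eLpNorm_add_eLpNorm_deriv (f := iteratedDeriv 2 f)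
            (f' := iteratedDeriv 3 f) (fun x => by
              rw [iteratedDeriv_succ (n := 2)]
              exact ((hfs.of_le le_top).differentiable_iteratedDeriv' 2 x).hasDerivAt)
            (hfs.continuous_iteratedDeriv 3 le_top) x
          have h2 : ‖iteratedDeriv 2 f x‖ₑ ≤ ENNReal.ofReal (A 2 / 8 + A 3 / 8) := by
            rw [ENNReal.ofReal_add (by linarith [hA0 2]) (by linarith [hA0 3])]
            exact h1.trans (add_le_add (hE 2) (hE 3))
          rw [Real.enorm_eq_ofReal_abs] at h2
          have h3 := (ENNReal.ofReal_le_ofReal_iff (by linarith [hA0 2, hA0 3])).1 h2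
          have h4 := abs_lagDeriv_two_le hfa hL hB (htL t ht) x
          have h5 : (1 : ℝ) ≤ Real.exp (γ * (((2 : ℕ) : ℝ) - 1) * t) := by
            apply Real.one_le_exp
            have := mul_nonneg hγ0 ht0
            norm_num
            linarith
          calc _ ≤ A 2 + 2 * A (2 + 1) := by norm_num; linarith [hA0 3]
            _ ≤ _ := le_mul_of_one_le_right (by linarith [hA0 2, hA0 (2 + 1)]) h5
        · have h1 := abs_lagDeriv_le hfa hL hB (htL t ht) (p := p)
            (mul_nonneg (hA0 _) (Real.exp_pos _).le) (mul_nonneg (hA0 _) (Real.exp_pos _).le)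
            (ih p (by omega) hp t ht) (ih (p + 1) (by omega) (by omega) t ht) x
          refine h1.trans ?_
          have e1 : Real.exp (γ * (p - 2) * t) ≤ Real.exp (γ * (p - 1) * t) := by
            apply Real.exp_le_exp.2
            gcongr
            norm_num
          have e2 : Real.exp (γ * (((p + 1 : ℕ) : ℝ) - 2) * t) = Real.exp (γ * (p - 1) * t) := by
            push_cast
            ring_nf
          rw [e2, add_mul]
          have := mul_le_mul_of_nonneg_left e1 (hA0 p)
          linarith
      have hsource : ∀ t ∈ Icc 0 T, eLpNorm (lagSource f n t) 2 volume ≤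
          ENNReal.ofReal (K * (n - 2) * A n * Real.exp (γ * (n - 2) * t)) := by
        intro t ht
        have ht0 := ht.1
        have hterm : ∀ j ∈ Finset.Ico 2 n, eLpNorm (fun x => (n.choose j : ℝ) *
            (lagDeriv f j t x * lagDeriv f (n + 1 - j) t x)) 2 volume ≤
            ENNReal.ofReal ((n.choose j : ℝ) *
              ((A (min j (n + 1 - j)) + 2 * A (min j (n + 1 - j) + 1)) *
                A (max j (n + 1 - j))) * Real.exp (γ * (n - 2) * t)) := by
          intro j hj
          have hj' := Finset.mem_Ico.1 hj
          set p := min j (n + 1 - j) with hp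
          set k := max j (n + 1 - j) with hk
          have hpk : p + k = n + 1 := by omega
          have hkr : (k : ℝ) = n + 1 - p := by
            have : ((p + k : ℕ) : ℝ) = ((n + 1 : ℕ) : ℝ) := by rw [hpk]
            push_cast at this
            linarith
          have hprod : ∀ x, lagDeriv f j t x * lagDeriv f (n + 1 - j) t x =
              lagDeriv f p t x * lagDeriv f k t x := by
            intro x
            rcases le_total j (n + 1 - j) with h | h
            · rw [hp, hk, min_eq_left h, max_eq_right h]
            · rw [hp, hk, min_eq_right h, max_eq_left h, mul_comm]
          set S := (A p + 2 * A (p + 1)) * Real.exp (γ * (p - 1) * t) with hS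
          have hA1 : 0 ≤ A p + 2 * A (p + 1) := by linarith [hA0 p, hA0 (p + 1)]
          have hS0 : 0 ≤ S := mul_nonneg hA1 (Real.exp_pos _).le
          have h1 : eLpNorm (fun x => (n.choose j : ℝ) *
              (lagDeriv f j t x * lagDeriv f (n + 1 - j) t x)) 2 volume ≤
              ENNReal.ofReal ((n.choose j : ℝ) * S) * eLpNorm (lagDeriv f k t) 2 volume := by
            refine eLpNorm_le_ofReal_mul fun x => ?_
            rw [hprod, abs_mul, abs_mul, Nat.abs_cast, ← mul_assoc]
            gcongr
            exact hsup p (by omega) (by omega) t ht x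
          refine (h1.trans (mul_le_mul' le_rfl (ih k (by omega) (by omega) t ht))).trans ?_
          rw [← ENNReal.ofReal_mul (by positivity)]
          refine le_of_eq (congrArg _ ?_)
          -- The exponents close up exactly: (p - 1) + (k - 2) = n - 2 because p + k = n + 1. The
          -- shift by 2 in the growth rate absorbs the derivative spent on the sup bound.
          have e : Real.exp (γ * (n - 2) * t) =
              Real.exp (γ * (p - 1) * t) * Real.exp (γ * (k - 2) * t) := by
            rw [← Real.exp_add, hkr]
            ring_nf
          rw [hS, e]
          ring
        have hsum : lagSource f n t = ∑ j ∈ Finset.Ico 2 n, fun x => (n.choose j : ℝ) *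
            (lagDeriv f j t x * lagDeriv f (n + 1 - j) t x) := by
          ext x
          simp [lagSource]
        rw [hsum]
        refine (eLpNorm_sum_le (fun j _ => ?_) (by norm_num)).trans ?_
        · exact (continuous_const.mul ((continuous_lagDeriv hfa hL hB (htL' t ht) _).mul
            (continuous_lagDeriv hfa hL hB (htL' t ht) _))).aestronglyMeasurable
        · refine (Finset.sum_le_sum hterm).trans ?_
          rw [← ENNReal.ofReal_sum_of_nonneg, ← Finset.sum_mul]
          · exact ENNReal.ofReal_le_ofReal
              (mul_le_mul_of_nonneg_right (hA n hn3) (Real.exp_pos _).le)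
          · intro j _
            have h1 := hA0 (min j (n + 1 - j))
            have h2 := hA0 (min j (n + 1 - j) + 1)
            have h3 := hA0 (max j (n + 1 - j))
            positivity
      intro t ht
      have ht0 := ht.1
      have hsub : ∀ s ∈ Icc 0 t, s ∈ Icc 0 T := fun s hs => ⟨hs.1, hs.2.trans ht.2⟩
      have hJt : ∀ x, 0 < 1 + t * deriv f x := fun x => one_add_mul_deriv_pos hL (htL' t ht) x
      -- the weighted derivative, constant in time up to the source
      set F : ℝ → ℝ → ℝ := fun s x =>
        ((1 + s * deriv f x) / (1 + t * deriv f x)) ^ (n + 1) * lagDeriv f n s x with hF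
      have hweight : ∀ s ∈ Icc 0 t, ∀ x,
          |((1 + s * deriv f x) / (1 + t * deriv f x)) ^ (n + 1)| ≤
            Real.exp (8 * L * (n - 2) * (t - s)) := by
        intro s hs x
        have h0 : 0 ≤ (1 + s * deriv f x) / (1 + t * deriv f x) :=
          div_nonneg (one_add_mul_deriv_pos hL (htL' s (hsub s hs)) x).le (hJt x).le
        rw [abs_of_nonneg (pow_nonneg h0 _)]
        refine (pow_le_pow_left₀ h0 (one_add_mul_deriv_div_le_exp hL (htL t ht) hs.2 x) _).trans ?_
        -- For n ≥ 3 one has n + 1 ≤ 4 (n - 2), which turns 2 L (n + 1) into 8 L (n - 2).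
        rw [← Real.exp_nat_mul]
        apply Real.exp_le_exp.2
        have h1 : 0 ≤ L * (t - s) := mul_nonneg hL0 (sub_nonneg.2 hs.2)
        push_cast
        nlinarith
      -- G is a primitive of the majorant g of the weighted source. The condition K ≤ (γ - 8 L) / 2
      -- puts the factor K (n - 2) below half the derivative of the exponent, so the integral costs
      -- at most half of the target.
      set G : ℝ → ℝ := fun s => 1 / 2 * A n *
        Real.exp (8 * L * (n - 2) * (t - s) + γ * (n - 2) * s) with hG
      set g : ℝ → ℝ := fun s => 1 / 2 * A n *
        (Real.exp (8 * L * (n - 2) * (t - s) + γ * (n - 2) * s) *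
          ((γ - 8 * L) * (n - 2))) with hg
      have hGg : ∀ s, HasDerivAt G (g s) s := by
        intro s
        have h1 : HasDerivAt (fun s : ℝ => 8 * L * (n - 2) * (t - s) + γ * (n - 2) * s)
            ((γ - 8 * L) * (n - 2)) s := by
          have := (((hasDerivAt_id s).const_sub t).const_mul (8 * L * ((n : ℝ) - 2))).add
            ((hasDerivAt_id s).const_mul (γ * ((n : ℝ) - 2)))
          refine this.congr_deriv ?_
          ring
        exact (h1.exp).const_mul _
      have hgc : Continuous g := by fun_prop
      have hn2 : (0 : ℝ) ≤ n - 2 := by linarith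
      have hgn : ∀ s ∈ Icc 0 t, 0 ≤ g s := fun s _ => by
        have h1 : 0 ≤ γ - 8 * L := by linarith
        have h2 := hA0 n
        positivity
      have hmain : eLpNorm (fun x => F t x - F 0 x) 2 volume ≤
          ENNReal.ofReal (∫ s in (0 : ℝ)..t, g s) := by
        refine eLpNorm_sub_le_integral ht0 (f := fun s x =>
          -(((1 + s * deriv f x) / (1 + t * deriv f x)) ^ (n + 1) * lagSource f n s x))
          (fun x s hs => hasDerivAt_pow_mul_lagDeriv hfa hL hB (htL' s (hsub s hs)) hn x _)
          ?_ hgc hgn ?_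
        · intro p hp
          have hlag : ∀ m, ContinuousAt (Function.uncurry (lagDeriv f m)) p := fun m =>
            (analyticAt_lagDeriv hfa hL hB (htL' p.1 (hsub p.1 hp.1)) m p.2).continuousAt
          have hs : ContinuousAt (Function.uncurry (lagSource f n)) p := by
            change ContinuousAt (fun q : ℝ × ℝ => ∑ j ∈ Finset.Ico 2 n, (n.choose j : ℝ) *
              (Function.uncurry (lagDeriv f j) q * Function.uncurry (lagDeriv f (n + 1 - j)) q)) p
            exact tendsto_finsetSum _ fun j _ => tendsto_const_nhds.mul ((hlag j).mul (hlag _))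
          have hw : ContinuousAt (fun q : ℝ × ℝ =>
              ((1 + q.1 * deriv f q.2) / (1 + t * deriv f q.2)) ^ (n + 1)) p := by
            have := (hJt p.2).ne'
            fun_prop (disch := assumption)
          exact ((hw.mul hs).neg).continuousWithinAt
        · intro s hs
          refine (eLpNorm_le_ofReal_mul (g := lagSource f n s)
            (c := Real.exp (8 * L * (n - 2) * (t - s))) fun x => ?_).trans ?_
          · rw [abs_neg, abs_mul]
            exact mul_le_mul_of_nonneg_right (hweight s hs x) (abs_nonneg _)
          · refine (mul_le_mul' le_rfl (hsource s (hsub s hs))).trans ?_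
            rw [← ENNReal.ofReal_mul (Real.exp_pos _).le]
            refine ENNReal.ofReal_le_ofReal ?_
            simp only [hg]
            rw [Real.exp_add]
            have h1 : K ≤ (γ - 8 * L) / 2 := by linarith
            have h2 : K * ((n - 2) * A n * (Real.exp (8 * L * (n - 2) * (t - s)) *
                Real.exp (γ * (n - 2) * s))) ≤ (γ - 8 * L) / 2 * ((n - 2) * A n *
                (Real.exp (8 * L * (n - 2) * (t - s)) * Real.exp (γ * (n - 2) * s))) := by
              refine mul_le_mul_of_nonneg_right h1 ?_
              have := hA0 n
              positivity
            linarith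
      have hint : ∫ s in (0 : ℝ)..t, g s ≤ 1 / 2 * A n * Real.exp (γ * (n - 2) * t) := by
        rw [intervalIntegral.integral_eq_sub_of_hasDerivAt (fun s _ => hGg s)
          (hgc.intervalIntegrable _ _)]
        have h1 : 0 ≤ G 0 := mul_nonneg (by linarith [hA0 n]) (Real.exp_pos _).le
        have h2 : G t = 1 / 2 * A n * Real.exp (γ * (n - 2) * t) := by simp [hG]
        linarith
      have hFt : F t = lagDeriv f n t := by
        ext x
        simp only [hF]
        rw [div_self (hJt x).ne', one_pow, one_mul]
      have hF0 : eLpNorm (F 0) 2 volume ≤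
          ENNReal.ofReal (1 / 8 * A n * Real.exp (γ * (n - 2) * t)) := by
        refine (eLpNorm_le_ofReal_mul (g := iteratedDeriv n f)
          (c := Real.exp (8 * L * (n - 2) * (t - 0))) fun x => ?_).trans ?_
        · rw [← lagDeriv_zero_time]
          simp only [hF]
          rw [abs_mul]
          exact mul_le_mul_of_nonneg_right (hweight 0 ⟨le_rfl, ht0⟩ x) (abs_nonneg _)
        · refine (mul_le_mul' le_rfl (hE n)).trans ?_
          rw [← ENNReal.ofReal_mul (Real.exp_pos _).le]
          refine ENNReal.ofReal_le_ofReal ?_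
          have h1 : Real.exp (8 * L * (n - 2) * (t - 0)) ≤ Real.exp (γ * (n - 2) * t) := by
            apply Real.exp_le_exp.2
            rw [sub_zero]
            gcongr
            linarith
          have := mul_le_mul_of_nonneg_right h1 (by linarith [hA0 n] : 0 ≤ A n / 8)
          linarith
      have hFc : ∀ s ∈ Icc 0 t, Continuous (F s) := by
        intro s hs
        refine Continuous.mul ?_ (continuous_lagDeriv hfa hL hB (htL' s (hsub s hs)) n)
        exact ((by fun_prop : Continuous fun x => 1 + s * deriv f x).div (by fun_prop)
          fun x => (hJt x).ne').pow _
      have hsplit : lagDeriv f n t = (fun x => F t x - F 0 x) + F 0 := by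
        rw [← hFt]
        ext x
        simp
      rw [hsplit]
      have hc0 := hFc 0 ⟨le_rfl, ht0⟩
      have hct := hFc t ⟨ht0, le_rfl⟩
      refine (eLpNorm_add_le (hct.sub hc0).aestronglyMeasurable hc0.aestronglyMeasurable
        (by norm_num)).trans ?_
      refine (add_le_add (hmain.trans (ENNReal.ofReal_le_ofReal hint)) hF0).trans ?_
      -- The source contributes 1/2 and the initial value 1/8 of the target bound.
      have h1 := mul_nonneg (hA0 n) (Real.exp_pos (γ * (n - 2) * t)).le
      rw [← ENNReal.ofReal_add (by linarith) (by linarith)]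
      refine ENNReal.ofReal_le_ofReal ?_
      linarith

end Energy

/-! ### Arithmetic of the weights -/

/-- The reciprocal `n! / (n ^ α ρ ^ n)` of the weight of the `n`-th term of the norm. -/
noncomputable def bBound (α ρ : ℝ) (n : ℕ) : ℝ :=
  (n.factorial : ℝ) / (((max n 1 : ℕ) : ℝ) ^ α * ρ ^ n)

section Weights

variable {α ρ : ℝ}

theorem one_le_max_cast (n : ℕ) : (1 : ℝ) ≤ ((max n 1 : ℕ) : ℝ) := by
  exact_mod_cast le_max_right n 1

theorem max_rpow_pos (α : ℝ) (n : ℕ) : 0 < ((max n 1 : ℕ) : ℝ) ^ α :=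
  Real.rpow_pos_of_pos (zero_lt_one.trans_le (one_le_max_cast n)) α

theorem factorial_cast_pos (n : ℕ) : (0 : ℝ) < n.factorial := by
  exact_mod_cast n.factorial_pos

theorem bBound_pos (α : ℝ) (hρ : 0 < ρ) (n : ℕ) : 0 < bBound α ρ n :=
  div_pos (factorial_cast_pos n) (mul_pos (max_rpow_pos α n) (pow_pos hρ n))

theorem bBound_le (hα : 0 ≤ α) (hρ : 0 < ρ) (n : ℕ) : bBound α ρ n ≤ n.factorial / ρ ^ n := by
  have h := factorial_cast_pos n
  have h1 : 1 ≤ ((max n 1 : ℕ) : ℝ) ^ α := Real.one_le_rpow (one_le_max_cast n) hα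
  unfold bBound
  gcongr
  exact le_mul_of_one_le_left (by positivity) h1

theorem bWeight_mul_bBound (α : ℝ) {r : ℝ} (hρ : 0 ≤ ρ) (hr : 0 < r) (c : ℝ) (n : ℕ) :
    bWeight α ρ n * ENNReal.ofReal (c * bBound α r n) = ENNReal.ofReal (c * (ρ / r) ^ n) := by
  have h := factorial_cast_pos n
  have h1 := max_rpow_pos α n
  rw [bWeight, ← ENNReal.ofReal_mul (by positivity), bBound, div_pow]
  congr 1
  field_simp

/-- With the same α on both sides the powers of n cancel, leaving a geometric series of ratio ρ / r;
this is the source of the factor ρ₁ / (ρ₁ - ρ) in the final estimate. -/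
theorem bENorm_le_of_eLpNorm_le {r : ℝ} (hρ : 0 ≤ ρ) (hr : ρ < r) {c : ℝ} (hc : 0 ≤ c) {f : ℝ → ℝ}
    (h : ∀ n, eLpNorm (iteratedDeriv n f) 2 volume ≤ ENNReal.ofReal (c * bBound α r n)) :
    bENorm α ρ f ≤ ENNReal.ofReal (c * (r / (r - ρ))) := by
  have hr0 : 0 < r := hρ.trans_lt hr
  have hq0 : 0 ≤ ρ / r := by positivity
  have hq1 : ρ / r < 1 := (div_lt_one hr0).2 hr
  have hs := (hasSum_geometric_of_lt_one hq0 hq1).mul_left c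
  have hval : r / (r - ρ) = (1 - ρ / r)⁻¹ := by
    have : r - ρ ≠ 0 := (sub_pos.2 hr).ne'
    field_simp
  calc bENorm α ρ f ≤ ∑' n : ℕ, ENNReal.ofReal (c * (ρ / r) ^ n) := by
        refine ENNReal.tsum_le_tsum fun n => ?_
        rw [← bWeight_mul_bBound α hρ hr0 c n]
        exact mul_le_mul' le_rfl (h n)
    _ = ENNReal.ofReal (c * (r / (r - ρ))) := by
        rw [← ENNReal.ofReal_tsum_of_nonneg (fun n => by positivity) hs.summable, hs.tsum_eq, hval]

theorem BSpace.eLpNorm_iteratedDeriv_le (hρ : 0 < ρ) (f : BSpace α ρ) (n : ℕ) :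
    eLpNorm (iteratedDeriv n f.toFun) 2 volume ≤ ENNReal.ofReal (‖f‖ * bBound α ρ n) := by
  have h1 : bWeight α ρ n * eLpNorm (iteratedDeriv n f.toFun) 2 volume ≤ ENNReal.ofReal ‖f‖ := by
    rw [BSpace.norm_def, ENNReal.ofReal_toReal f.bENorm_ne_top]
    exact ENNReal.le_tsum n
  have h2 := bWeight_mul_bBound α hρ.le hρ 1 n
  rw [div_self hρ.ne', one_pow, one_mul, mul_one, ENNReal.ofReal_one] at h2
  calc eLpNorm (iteratedDeriv n f.toFun) 2 volume
      = (bWeight α ρ n * ENNReal.ofReal (bBound α ρ n)) *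
        eLpNorm (iteratedDeriv n f.toFun) 2 volume := by rw [h2, one_mul]
    _ = (bWeight α ρ n * eLpNorm (iteratedDeriv n f.toFun) 2 volume) *
        ENNReal.ofReal (bBound α ρ n) := by ring
    _ ≤ ENNReal.ofReal ‖f‖ * ENNReal.ofReal (bBound α ρ n) := mul_le_mul' h1 le_rfl
    _ = _ := (ENNReal.ofReal_mul (norm_nonneg f)).symm

theorem choose_mul_factorial_mul_factorial_le {n j : ℕ} (hj : 1 ≤ j) (hjn : j ≤ n) :
    n.choose j * ((min j (n + 1 - j)).factorial * (max j (n + 1 - j)).factorial) ≤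
      n * n.factorial := by
  have h1 : (min j (n + 1 - j)).factorial * (max j (n + 1 - j)).factorial =
      j.factorial * (n + 1 - j).factorial := by
    rcases le_total j (n + 1 - j) with h | h
    · rw [min_eq_left h, max_eq_right h]
    · rw [min_eq_right h, max_eq_left h, mul_comm]
  have h2 : n + 1 - j = (n - j) + 1 := by omega
  rw [h1, h2, Nat.factorial_succ]
  calc n.choose j * (j.factorial * ((n - j + 1) * (n - j).factorial))
      = (n - j + 1) * (n.choose j * j.factorial * (n - j).factorial) := by ring
    _ = (n - j + 1) * n.factorial := by rw [Nat.choose_mul_factorial_mul_factorial hjn]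
    _ ≤ n * n.factorial := Nat.mul_le_mul_right _ (by omega)

theorem bBound_succ_le (hα : 0 ≤ α) (hρ : 0 < ρ) {p : ℕ} (hp : 1 ≤ p) :
    bBound α ρ (p + 1) ≤ 2 * p / ρ * bBound α ρ p := by
  have hpr : (1 : ℝ) ≤ p := by exact_mod_cast hp
  have hf := factorial_cast_pos p
  have h1 : ((p : ℝ)) ^ α ≤ ((p : ℝ) + 1) ^ α := Real.rpow_le_rpow (by linarith) (by linarith) hα
  have h2 : 0 < (p : ℝ) ^ α := Real.rpow_pos_of_pos (by linarith) α
  unfold bBound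
  rw [max_eq_left hp, max_eq_left (by omega), Nat.factorial_succ]
  push_cast
  calc ((p : ℝ) + 1) * p.factorial / (((p : ℝ) + 1) ^ α * ρ ^ (p + 1))
      ≤ (2 * p) * p.factorial / ((p : ℝ) ^ α * ρ ^ (p + 1)) := by
        gcongr
        linarith
    _ = _ := by
        rw [pow_succ]
        field_simp

/-- The binomial and the two factorials give n · n!. The smaller index p carries the extra
derivative, costing a factor of order p, so p^(-α) becomes p^(1-α); the larger index is at least n /
2, so its power is comparable to n^(-α). Replacing p^(1-α) by the sum over both indices removes the
minimum before summation. -/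
theorem choose_mul_bBound_le (hα : 0 ≤ α) (hρ : 0 < ρ) {n j : ℕ} (hj : 1 ≤ j) (hjn : j ≤ n) :
    (n.choose j : ℝ) * ((bBound α ρ (min j (n + 1 - j)) + 2 * bBound α ρ (min j (n + 1 - j) + 1)) *
      bBound α ρ (max j (n + 1 - j))) ≤
      ((1 + 4 / ρ) * 2 ^ α / ρ) * (n * bBound α ρ n) *
        ((j : ℝ) ^ (1 - α) + ((n + 1 - j : ℕ) : ℝ) ^ (1 - α)) := by
  have hfac := choose_mul_factorial_mul_factorial_le hj hjn
  have hmin : ((min j (n + 1 - j) : ℕ) : ℝ) ^ (1 - α) ≤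
      (j : ℝ) ^ (1 - α) + ((n + 1 - j : ℕ) : ℝ) ^ (1 - α) := by
    have h1 : 0 ≤ (j : ℝ) ^ (1 - α) := by positivity
    have h2 : 0 ≤ ((n + 1 - j : ℕ) : ℝ) ^ (1 - α) := by positivity
    rcases le_total j (n + 1 - j) with h | h
    · rw [min_eq_left h]; linarith
    · rw [min_eq_right h]; linarith
  set p := min j (n + 1 - j) with hp
  set k := max j (n + 1 - j) with hk
  have hpk : p + k = n + 1 := by omega
  have hp1 : 1 ≤ p := by omega
  have hk1 : 1 ≤ k := by omega
  have hn1 : 1 ≤ n := by omega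
  have hpr : (1 : ℝ) ≤ p := by exact_mod_cast hp1
  have hnr : (1 : ℝ) ≤ n := by exact_mod_cast hn1
  have hfacr : (n.choose j : ℝ) * ((p.factorial : ℝ) * k.factorial) ≤ n * n.factorial := by
    exact_mod_cast hfac
  have h1 : bBound α ρ p + 2 * bBound α ρ (p + 1) ≤ (1 + 4 / ρ) * p * bBound α ρ p := by
    have h2 := bBound_succ_le hα hρ hp1
    have h3 := bBound_pos α hρ p
    have h4 : bBound α ρ p ≤ p * bBound α ρ p := le_mul_of_one_le_left h3.le hpr
    calc _ ≤ p * bBound α ρ p + 2 * (2 * p / ρ * bBound α ρ p) := by gcongr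
      _ = _ := by ring
  have hkα : (k : ℝ) ^ (-α) ≤ 2 ^ α * (n : ℝ) ^ (-α) := by
    have hkn : (n : ℝ) / 2 ≤ k := by
      have : n ≤ 2 * k := by omega
      have : (n : ℝ) ≤ 2 * k := by exact_mod_cast this
      linarith
    calc (k : ℝ) ^ (-α) ≤ ((n : ℝ) / 2) ^ (-α) :=
          Real.rpow_le_rpow_of_nonpos (by linarith) hkn (by linarith)
      _ = 2 ^ α * (n : ℝ) ^ (-α) := by
          rw [Real.div_rpow (by linarith) (by norm_num), Real.rpow_neg (by norm_num : (0 : ℝ) ≤ 2)]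
          field_simp
  have hb : ∀ m : ℕ, 1 ≤ m → bBound α ρ m = m.factorial * (m : ℝ) ^ (-α) * (ρ ^ m)⁻¹ := by
    intro m hm
    rw [bBound, max_eq_left hm, Real.rpow_neg (Nat.cast_nonneg m)]
    field_simp
  have hpα : (p : ℝ) * (p : ℝ) ^ (-α) = (p : ℝ) ^ (1 - α) := by
    rw [sub_eq_add_neg, Real.rpow_add (by linarith), Real.rpow_one]
  have hρpk : (ρ ^ p)⁻¹ * (ρ ^ k)⁻¹ = (ρ ^ n)⁻¹ * ρ⁻¹ := by
    rw [← mul_inv, ← pow_add, hpk, pow_succ, mul_inv]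
  have hk0 := (bBound_pos α hρ k).le
  have hC : 0 ≤ 1 + 4 / ρ := by positivity
  calc (n.choose j : ℝ) * ((bBound α ρ p + 2 * bBound α ρ (p + 1)) * bBound α ρ k)
      ≤ (n.choose j : ℝ) * (((1 + 4 / ρ) * p * bBound α ρ p) * bBound α ρ k) := by gcongr
    _ = ((n.choose j : ℝ) * ((p.factorial : ℝ) * k.factorial)) *
        ((1 + 4 / ρ) * (p * (p : ℝ) ^ (-α)) * (k : ℝ) ^ (-α) *
          ((ρ ^ p)⁻¹ * (ρ ^ k)⁻¹)) := by
        rw [hb p hp1, hb k hk1]; ring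
    _ ≤ (n * n.factorial) * ((1 + 4 / ρ) * (p * (p : ℝ) ^ (-α)) * (2 ^ α * (n : ℝ) ^ (-α)) *
          ((ρ ^ p)⁻¹ * (ρ ^ k)⁻¹)) := by gcongr
    _ = ((1 + 4 / ρ) * 2 ^ α / ρ) * (n * bBound α ρ n) * (p : ℝ) ^ (1 - α) := by
        rw [hpα, hρpk, hb n hn1]; ring
    _ ≤ _ := by
        have := (bBound_pos α hρ n).le
        gcongr

/-- The weights form an approximate convolution algebra for the quadratic term of the Burgers
equation. -/
theorem exists_sum_choose_mul_bBound_le (hα : 2 < α) (hρ : 0 < ρ) :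
    ∃ C : ℝ, 0 ≤ C ∧ ∀ n : ℕ, 3 ≤ n → ∑ j ∈ Finset.Ico 2 n, (n.choose j : ℝ) *
      ((bBound α ρ (min j (n + 1 - j)) + 2 * bBound α ρ (min j (n + 1 - j) + 1)) *
        bBound α ρ (max j (n + 1 - j))) ≤ C * (n - 2) * bBound α ρ n := by
  set Z : ℝ := ∑' j : ℕ, (j : ℝ) ^ (1 - α) with hZ
  have hs : Summable fun j : ℕ => (j : ℝ) ^ (1 - α) := Real.summable_nat_rpow.2 (by linarith)
  have hnn : ∀ j : ℕ, 0 ≤ (j : ℝ) ^ (1 - α) := fun j => by positivity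
  have hZ0 : 0 ≤ Z := tsum_nonneg hnn
  set D : ℝ := (1 + 4 / ρ) * 2 ^ α / ρ with hD
  have hD0 : 0 ≤ D := by positivity
  -- The 6 is 3 · 2: n ≤ 3 (n - 2) for n ≥ 3, and each of the two reflected sums is at most Z.
  refine ⟨6 * D * Z, by positivity, fun n hn => ?_⟩
  have hnr : (3 : ℝ) ≤ n := by exact_mod_cast hn
  have hbn := (bBound_pos α hρ n).le
  have h1 : ∑ j ∈ Finset.Ico 2 n, (j : ℝ) ^ (1 - α) ≤ Z := hs.sum_le_tsum _ fun j _ => hnn j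
  have h2 : ∑ j ∈ Finset.Ico 2 n, ((n + 1 - j : ℕ) : ℝ) ^ (1 - α) ≤ Z := by
    rw [Finset.sum_Ico_reflect (fun j : ℕ => (j : ℝ) ^ (1 - α)) 2 (by omega)]
    exact hs.sum_le_tsum _ fun j _ => hnn j
  calc _ ≤ ∑ j ∈ Finset.Ico 2 n, D * (n * bBound α ρ n) *
        ((j : ℝ) ^ (1 - α) + ((n + 1 - j : ℕ) : ℝ) ^ (1 - α)) :=
        Finset.sum_le_sum fun j hj => by
          have := Finset.mem_Ico.1 hj
          exact choose_mul_bBound_le (by linarith) hρ (by omega) (by omega)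
    _ ≤ D * (n * bBound α ρ n) * (Z + Z) := by
        rw [← Finset.mul_sum, Finset.sum_add_distrib]
        gcongr
    _ ≤ D * ((3 * (n - 2)) * bBound α ρ n) * (Z + Z) := by
        gcongr
        linarith
    _ = _ := by ring

/-- Polynomial growth is absorbed by a geometric factor. -/
theorem exists_rpow_mul_pow_le (β : ℝ) {q : ℝ} (hq0 : 0 ≤ q) (hq1 : q < 1) :
    ∃ K : ℝ, 0 ≤ K ∧ ∀ n : ℕ, ((max n 1 : ℕ) : ℝ) ^ β * q ^ n ≤ K := by
  have h := tendsto_pow_const_mul_const_pow_of_abs_lt_one ⌈β⌉₊ (r := q)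
    (by rwa [abs_of_nonneg hq0])
  obtain ⟨K, hK⟩ := h.bddAbove_range
  refine ⟨max K 1, by positivity, fun n => ?_⟩
  rcases Nat.eq_zero_or_pos n with rfl | hn
  · simp
  · have hn1 : (1 : ℝ) ≤ n := by exact_mod_cast hn
    rw [max_eq_left hn]
    refine le_trans ?_ ((hK ⟨n, rfl⟩).trans (le_max_left _ _))
    simp only
    gcongr
    rw [← Real.rpow_natCast]
    exact Real.rpow_le_rpow_of_exponent_le hn1 (Nat.le_ceil β)

end Weights

/-- Change variables by the flow map: the squared norm acquires the factor J ≤ 3/2 ≤ 2². -/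
theorem eLpNorm_spaceDeriv_burgersSol_le {f : ℝ → ℝ} {L B t : ℝ} (hfa : ∀ x, AnalyticAt ℝ f x)
    (hL : ∀ x, |deriv f x| ≤ L) (hB : ∀ x, |f x| ≤ B) (ht : |t| * L ≤ 1 / 2) (n : ℕ) :
    eLpNorm (iteratedDeriv n (burgersSol f t)) 2 volume ≤
      ENNReal.ofReal 2 * eLpNorm (lagDeriv f n t) 2 volume := by
  have hf : Differentiable ℝ f := fun x => (hfa x).differentiableAt
  have ht' : |t| * L < 1 := by linarith
  rw [← ENNReal.pow_le_pow_left_iff two_ne_zero, mul_pow, ← lintegral_enorm_sq_eq_eLpNorm_sq,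
    ← lintegral_enorm_sq_eq_eLpNorm_sq]
  have hcov := lintegral_image_eq_lintegral_abs_deriv_mul (s := univ) MeasurableSet.univ
    (fun x _ => (hasDerivAt_flowMap (t := t) hf x).hasDerivWithinAt)
    (flowMap_injective hf hL ht').injOn
    (fun y => ‖iteratedDeriv n (burgersSol f t) y‖ₑ ^ 2)
  rw [image_univ, (flowMap_surjective hf hB).range_eq, Measure.restrict_univ] at hcov
  rw [hcov, ← lintegral_const_mul' _ _ (by simp)]
  refine lintegral_mono fun x => ?_
  simp only
  rw [iteratedDeriv_eq_spaceDeriv_iterate]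
  refine mul_le_mul' ?_ le_rfl
  have hJ := one_add_mul_deriv_mem_Icc hL ht x
  rw [← ENNReal.ofReal_pow (by norm_num)]
  refine ENNReal.ofReal_le_ofReal ?_
  rw [abs_of_nonneg (by linarith [hJ.1])]
  linarith [hJ.2]

/-! ### Factorial L² bounds, stable under derivatives and products -/

/-- The space derivatives of `G` satisfy analytic `L²` bounds on `[0, T]`, for every radius below
`R`. -/
def FactorialBound (T R : ℝ) (G : ℝ → ℝ → ℝ) : Prop :=
  ∀ r, 0 < r → r < R → ∃ K : ℝ, 0 ≤ K ∧ ∀ n : ℕ, ∀ t ∈ Icc 0 T,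
    eLpNorm (iteratedDeriv n (G t)) 2 volume ≤ ENNReal.ofReal (K * (n.factorial / r ^ n))

section FactorialBound

variable {T R : ℝ} {F G : ℝ → ℝ → ℝ}

theorem FactorialBound.const_mul (hG : FactorialBound T R G) (c : ℝ) :
    FactorialBound T R fun t x => c * G t x := by
  intro r hr hrR
  obtain ⟨K, hK0, hK⟩ := hG r hr hrR
  refine ⟨|c| * K, by positivity, fun n t ht => ?_⟩
  have h1 : iteratedDeriv n (fun x => c * G t x) = fun x => c * iteratedDeriv n (G t) x :=
    funext fun x => iteratedDeriv_const_mul_field c (G t)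
  rw [h1, mul_assoc, ENNReal.ofReal_mul (abs_nonneg c)]
  exact (eLpNorm_le_ofReal_mul fun x => (abs_mul c _).le).trans (mul_le_mul' le_rfl (hK n t ht))

/-- The factor n + 1 produced by the shift of the factorial is absorbed by passing to an
intermediate radius, which is why the bound is required for every radius below R and not at R. -/
theorem FactorialBound.spaceDeriv (hG : FactorialBound T R G) :
    FactorialBound T R (spaceDeriv G) := by
  intro r hr hrR
  obtain ⟨s, hrs, hsR⟩ := exists_between hrR
  have hs : 0 < s := hr.trans hrs
  obtain ⟨K, hK0, hK⟩ := hG s hs hsR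
  obtain ⟨K', hK'0, hK'⟩ := exists_rpow_mul_pow_le 1 (q := r / s) (by positivity)
    ((div_lt_one hs).2 hrs)
  refine ⟨K * (2 * K' / s), by positivity, fun n t ht => ?_⟩
  have h1 : iteratedDeriv n (_root_.spaceDeriv G t) = iteratedDeriv (n + 1) (G t) :=
    iteratedDeriv_succ'.symm
  rw [h1]
  refine (hK (n + 1) t ht).trans (ENNReal.ofReal_le_ofReal ?_)
  rw [mul_assoc]
  refine mul_le_mul_of_nonneg_left ?_ hK0
  have h2 := hK' n
  rw [Real.rpow_one, div_pow] at h2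
  have h3 : (n : ℝ) + 1 ≤ 2 * ((max n 1 : ℕ) : ℝ) := by
    have : n + 1 ≤ 2 * max n 1 := by omega
    exact_mod_cast this
  have hf := factorial_cast_pos n
  rw [Nat.factorial_succ]
  push_cast
  calc ((n : ℝ) + 1) * n.factorial / s ^ (n + 1)
      = ((n : ℝ) + 1) * (r ^ n / s ^ n) / s * (n.factorial / r ^ n) := by
        rw [pow_succ]; field_simp
    _ ≤ (2 * ((max n 1 : ℕ) : ℝ)) * (r ^ n / s ^ n) / s * (n.factorial / r ^ n) := by gcongr
    _ = 2 * (((max n 1 : ℕ) : ℝ) * (r ^ n / s ^ n)) / s * (n.factorial / r ^ n) := by ring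
    _ ≤ 2 * K' / s * (n.factorial / r ^ n) := by gcongr

theorem FactorialBound.spaceDeriv_iterate (hG : FactorialBound T R G) (k : ℕ) :
    FactorialBound T R (_root_.spaceDeriv^[k] G) := by
  induction k with
  | zero => exact hG
  | succ k ih =>
    rw [Function.iterate_succ_apply']
    exact ih.spaceDeriv

theorem abs_iteratedDeriv_le_of_eLpNorm_le {f : ℝ → ℝ} (hf : ContDiff ℝ ∞ f) {n : ℕ} {a b : ℝ}
    (ha : 0 ≤ a) (hb : 0 ≤ b) (h0 : eLpNorm (iteratedDeriv n f) 2 volume ≤ ENNReal.ofReal a)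
    (h1 : eLpNorm (iteratedDeriv (n + 1) f) 2 volume ≤ ENNReal.ofReal b) (x : ℝ) :
    |iteratedDeriv n f x| ≤ a + b := by
  have h2 := enorm_le_eLpNorm_add_eLpNorm_deriv (f := iteratedDeriv n f)
    (f' := iteratedDeriv (n + 1) f) (fun x => by
      rw [iteratedDeriv_succ]
      exact ((contDiff_nat_of_smooth hf (n + 1)).differentiable_iteratedDeriv' n x).hasDerivAt)
    (hf.continuous_iteratedDeriv (n + 1) (by exact_mod_cast le_top)) x
  have h3 := h2.trans (add_le_add h0 h1)
  rw [← ENNReal.ofReal_add ha hb, Real.enorm_eq_ofReal_abs] at h3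
  exact (ENNReal.ofReal_le_ofReal_iff (add_nonneg ha hb)).1 h3

/-- Each Leibniz term takes f in sup norm and g in L². The derivative spent on the sup bound costs
one factor n + 1, and the number of terms the other. -/
theorem eLpNorm_iteratedDeriv_mul_le {f g : ℝ → ℝ} (hf : ContDiff ℝ ∞ f) (hg : ContDiff ℝ ∞ g)
    {K K' s : ℝ} (hK : 0 ≤ K) (hK' : 0 ≤ K') (hs : 0 < s)
    (hfb : ∀ n, eLpNorm (iteratedDeriv n f) 2 volume ≤ ENNReal.ofReal (K * (n.factorial / s ^ n)))
    (hgb : ∀ n, eLpNorm (iteratedDeriv n g) 2 volume ≤ ENNReal.ofReal (K' * (n.factorial / s ^ n)))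
    (n : ℕ) : eLpNorm (iteratedDeriv n fun x => f x * g x) 2 volume ≤
      ENNReal.ofReal (K * K' * (1 + 1 / s) * (((n : ℝ) + 1) ^ 2 * (n.factorial / s ^ n))) := by
  have h1 : (iteratedDeriv n fun x => f x * g x) = ∑ j ∈ Finset.range (n + 1), fun x =>
      (n.choose j : ℝ) * iteratedDeriv j f x * iteratedDeriv (n - j) g x := by
    ext x
    rw [iteratedDeriv_fun_mul (contDiff_nat_of_smooth hf n).contDiffAt
      (contDiff_nat_of_smooth hg n).contDiffAt]
    simp
  have hc : ∀ {h : ℝ → ℝ}, ContDiff ℝ ∞ h → ∀ m, Continuous (iteratedDeriv m h) := fun hh m =>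
    hh.continuous_iteratedDeriv m (by exact_mod_cast le_top)
  have hfp := factorial_cast_pos
  have hterm : ∀ j ∈ Finset.range (n + 1), eLpNorm (fun x =>
      (n.choose j : ℝ) * iteratedDeriv j f x * iteratedDeriv (n - j) g x) 2 volume ≤
      ENNReal.ofReal (K * K' * (1 + 1 / s) * (((n : ℝ) + 1) * (n.factorial / s ^ n))) := by
    intro j hj
    have hjn : j ≤ n := Nat.lt_succ_iff.1 (Finset.mem_range.1 hj)
    have hj0 := hfp j
    have hj1 := hfp (j + 1)
    have hj2 := hfp (n - j)
    refine (eLpNorm_le_ofReal_mul (g := iteratedDeriv (n - j) g)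
      (c := (n.choose j : ℝ) * (K * (j.factorial / s ^ j) +
        K * ((j + 1).factorial / s ^ (j + 1)))) fun x => ?_).trans ?_
    · rw [abs_mul, abs_mul, Nat.abs_cast]
      gcongr
      exact abs_iteratedDeriv_le_of_eLpNorm_le hf (by positivity) (by positivity) (hfb j)
        (hfb (j + 1)) x
    · refine (mul_le_mul' le_rfl (hgb (n - j))).trans ?_
      rw [← ENNReal.ofReal_mul (by positivity)]
      refine ENNReal.ofReal_le_ofReal ?_
      have hch : (n.choose j : ℝ) * j.factorial * (n - j).factorial = n.factorial := by
        exact_mod_cast Nat.choose_mul_factorial_mul_factorial hjn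
      have hpow : s ^ n = s ^ j * s ^ (n - j) := by rw [← pow_add, Nat.add_sub_cancel' hjn]
      have hjr : (j : ℝ) ≤ n := by exact_mod_cast hjn
      have hn0 := hfp n
      calc (n.choose j : ℝ) * (K * (j.factorial / s ^ j) +
            K * ((j + 1).factorial / s ^ (j + 1))) * (K' * ((n - j).factorial / s ^ (n - j)))
          = K * K' * (((n.choose j : ℝ) * j.factorial * (n - j).factorial) / s ^ n) *
              (1 + (j + 1) / s) := by
            rw [Nat.factorial_succ, hpow, pow_succ]
            push_cast
            field_simp
        _ = K * K' * (n.factorial / s ^ n) * (1 + (j + 1) / s) := by rw [hch]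
        _ ≤ K * K' * (n.factorial / s ^ n) * ((1 + 1 / s) * (n + 1)) := by
            have h2 : 1 + (j + 1) / s ≤ (1 + 1 / s) * ((n : ℝ) + 1) := by
              have h3 : ((j : ℝ) + 1) / s ≤ (n + 1) / s := by gcongr
              have h4 : (0 : ℝ) ≤ n := Nat.cast_nonneg n
              have h5 : (1 + 1 / s) * ((n : ℝ) + 1) = 1 + n + (n + 1) / s := by ring
              linarith
            gcongr
        _ = _ := by ring
  rw [h1]
  refine (eLpNorm_sum_le (fun j _ => ?_) (by norm_num)).trans ?_
  · exact ((continuous_const.mul (hc hf j)).mul (hc hg (n - j))).aestronglyMeasurable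
  · refine (Finset.sum_le_sum hterm).trans ?_
    rw [Finset.sum_const, Finset.card_range, ← ENNReal.ofReal_nsmul]
    refine ENNReal.ofReal_le_ofReal (le_of_eq ?_)
    rw [nsmul_eq_mul]
    push_cast
    ring

theorem FactorialBound.mul (hF : FactorialBound T R F) (hG : FactorialBound T R G)
    (hFs : ∀ t ∈ Icc 0 T, ContDiff ℝ ∞ (F t)) (hGs : ∀ t ∈ Icc 0 T, ContDiff ℝ ∞ (G t)) :
    FactorialBound T R fun t x => F t x * G t x := by
  intro r hr hrR
  obtain ⟨s, hrs, hsR⟩ := exists_between hrR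
  have hs : 0 < s := hr.trans hrs
  obtain ⟨K, hK0, hK⟩ := hF s hs hsR
  obtain ⟨K', hK'0, hK'⟩ := hG s hs hsR
  obtain ⟨Q, hQ0, hQ⟩ := exists_rpow_mul_pow_le 2 (q := r / s) (by positivity)
    ((div_lt_one hs).2 hrs)
  refine ⟨K * K' * (1 + 1 / s) * (4 * Q), by positivity, fun n t ht => ?_⟩
  refine (eLpNorm_iteratedDeriv_mul_le (hFs t ht) (hGs t ht) hK0 hK'0 hs (fun n => hK n t ht)
    (fun n => hK' n t ht) n).trans (ENNReal.ofReal_le_ofReal ?_)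
  rw [mul_assoc _ (4 * Q)]
  refine mul_le_mul_of_nonneg_left ?_ (by positivity)
  have h2 := hQ n
  rw [Real.rpow_two, div_pow] at h2
  have h3 : (n : ℝ) + 1 ≤ 2 * ((max n 1 : ℕ) : ℝ) := by
    have : n + 1 ≤ 2 * max n 1 := by omega
    exact_mod_cast this
  have hf := factorial_cast_pos n
  calc ((n : ℝ) + 1) ^ 2 * (n.factorial / s ^ n)
      = ((n : ℝ) + 1) ^ 2 * (r ^ n / s ^ n) * (n.factorial / r ^ n) := by field_simp
    _ ≤ (2 * ((max n 1 : ℕ) : ℝ)) ^ 2 * (r ^ n / s ^ n) * (n.factorial / r ^ n) := by gcongr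
    _ = 4 * (((max n 1 : ℕ) : ℝ) ^ 2 * (r ^ n / s ^ n)) * (n.factorial / r ^ n) := by ring
    _ ≤ 4 * Q * (n.factorial / r ^ n) := by gcongr

theorem FactorialBound.pow_succ (hG : FactorialBound T R G)
    (hGs : ∀ t ∈ Icc 0 T, ContDiff ℝ ∞ (G t)) (k : ℕ) :
    FactorialBound T R fun t x => G t x ^ (k + 1) := by
  induction k with
  | zero => simpa using hG
  | succ k ih =>
    have h := ih.mul hG (fun t ht => (hGs t ht).pow (k + 1)) hGs
    simpa only [← _root_.pow_succ] using h

end FactorialBound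

/-! ### From factorial bounds to elements of B_{α,ρ} -/

section BNorm

variable {α ρ : ℝ}

/-- Analytic `L²` bounds of radius larger than `ρ` control the norm of `B_{α,ρ}`. -/
theorem exists_bENorm_le (α : ℝ) {r : ℝ} (hρ : 0 < ρ) (hr : ρ < r) :
    ∃ C : ℝ, 0 ≤ C ∧ ∀ (f : ℝ → ℝ) (K : ℝ), 0 ≤ K →
      (∀ n, eLpNorm (iteratedDeriv n f) 2 volume ≤ ENNReal.ofReal (K * (n.factorial / r ^ n))) →
      bENorm α ρ f ≤ ENNReal.ofReal (K * C) := by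
  -- Two gaps are used: from r to s to absorb n^α, and from s to ρ to sum the geometric series.
  obtain ⟨s, hρs, hsr⟩ := exists_between hr
  have hs : 0 < s := hρ.trans hρs
  have hr0 : 0 < r := hs.trans hsr
  obtain ⟨Q, hQ0, hQ⟩ := exists_rpow_mul_pow_le α (q := s / r) (by positivity)
    ((div_lt_one hr0).2 hsr)
  have h1 : 0 < s - ρ := sub_pos.2 hρs
  refine ⟨Q * (s / (s - ρ)), by positivity, fun f K hK hf => ?_⟩
  rw [← mul_assoc]
  refine bENorm_le_of_eLpNorm_le hρ.le hρs (by positivity) fun n => ?_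
  refine (hf n).trans (ENNReal.ofReal_le_ofReal ?_)
  have h2 := hQ n
  have h3 := max_rpow_pos α n
  have hfac := factorial_cast_pos n
  rw [div_pow] at h2
  rw [mul_assoc]
  refine mul_le_mul_of_nonneg_left ?_ hK
  calc (n.factorial : ℝ) / r ^ n
      = (((max n 1 : ℕ) : ℝ) ^ α * (s ^ n / r ^ n)) * bBound α s n := by
        rw [bBound]; field_simp
    _ ≤ Q * bBound α s n := mul_le_mul_of_nonneg_right h2 (bBound_pos α hs n).le

theorem FactorialBound.bENorm_ne_top {T R : ℝ} {G : ℝ → ℝ → ℝ} (hG : FactorialBound T R G)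
    (hρ : 0 < ρ) (hR : ρ < R) {t : ℝ} (ht : t ∈ Icc 0 T) : bENorm α ρ (G t) ≠ ⊤ := by
  obtain ⟨r, hρr, hrR⟩ := exists_between hR
  obtain ⟨K, hK0, hK⟩ := hG r (hρ.trans hρr) hrR
  obtain ⟨C, -, hC⟩ := exists_bENorm_le α hρ hρr
  exact ne_top_of_le_ne_top ENNReal.ofReal_ne_top (hC (G t) K hK0 fun n => hK n t ht)

/-- An element of `B_{α,ρ}` from its underlying function. -/
def BSpace.ofMem {f : ℝ → ℝ} (h : f ∈ bSubmodule α ρ) : BSpace α ρ :=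
  (⟨f, h⟩ : bSubmodule α ρ)

open Classical in
/-- A function of the space variable as an element of `B_{α,ρ}`, zero if it does not belong to
this space. -/
noncomputable def toBSpace (α ρ : ℝ) (f : ℝ → ℝ) : BSpace α ρ :=
  if h : f ∈ bSubmodule α ρ then BSpace.ofMem h else 0

theorem toFun_toBSpace {f : ℝ → ℝ} (hf : ContDiff ℝ ∞ f) (h : bENorm α ρ f ≠ ⊤) :
    (toBSpace α ρ f).toFun = f := by
  have hm : f ∈ bSubmodule α ρ := ⟨hf, h⟩
  rw [toBSpace, dif_pos hm]
  rfl

end BNorm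

/-! ### Differentiability in time with values in B_{α,ρ} -/

section TimeRegularity

theorem eLpNorm_sub_le_mul_abs_sub {a b c : ℝ} (hc : 0 ≤ c) {F f : ℝ → ℝ → ℝ}
    (hF : ∀ x, ∀ s ∈ uIcc a b, HasDerivAt (fun s => F s x) (f s x) s)
    (hf : ContinuousOn (Function.uncurry f) (uIcc a b ×ˢ univ))
    (h : ∀ s ∈ uIcc a b, eLpNorm (f s) 2 volume ≤ ENNReal.ofReal c) :
    eLpNorm (fun x => F b x - F a x) 2 volume ≤ ENNReal.ofReal (c * |b - a|) := by
  rcases le_total a b with hab | hab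
  · rw [uIcc_of_le hab] at hF hf h
    have := eLpNorm_sub_le_integral hab hF hf continuous_const (fun _ _ => hc) h
    rwa [intervalIntegral.integral_const, smul_eq_mul, mul_comm,
      ← abs_of_nonneg (sub_nonneg.2 hab)] at this
  · rw [uIcc_of_ge hab] at hF hf h
    have := eLpNorm_sub_le_integral hab hF hf continuous_const (fun _ _ => hc) h
    rw [intervalIntegral.integral_const, smul_eq_mul, mul_comm,
      ← abs_of_nonneg (sub_nonneg.2 hab), abs_sub_comm] at this
    have e : (fun x => F b x - F a x) = -fun x => F a x - F b x := by
      ext x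
      simp
    rwa [e, eLpNorm_neg]

/-- The first order Taylor remainder in time, in `L²`. -/
theorem eLpNorm_taylor_le {T c : ℝ} (hc : 0 ≤ c) {F F₁ F₂ : ℝ → ℝ → ℝ}
    (hF : ∀ x, ∀ s ∈ Icc 0 T, HasDerivAt (fun s => F s x) (F₁ s x) s)
    (hF₁ : ∀ x, ∀ s ∈ Icc 0 T, HasDerivAt (fun s => F₁ s x) (F₂ s x) s)
    (hc₁ : ContinuousOn (Function.uncurry F₁) (Icc 0 T ×ˢ univ))
    (hc₂ : ContinuousOn (Function.uncurry F₂) (Icc 0 T ×ˢ univ))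
    (h : ∀ s ∈ Icc 0 T, eLpNorm (F₂ s) 2 volume ≤ ENNReal.ofReal c) {t s : ℝ}
    (ht : t ∈ Icc 0 T) (hs : s ∈ Icc 0 T) :
    eLpNorm (fun x => F s x - F t x - (s - t) * F₁ t x) 2 volume ≤
      ENNReal.ofReal (c * |s - t| ^ 2) := by
  have hsub : uIcc t s ⊆ Icc 0 T := ordConnected_Icc.uIcc_subset ht hs
  have h1 : ∀ r ∈ uIcc t s, eLpNorm (fun x => F₁ r x - F₁ t x) 2 volume ≤
      ENNReal.ofReal (c * |s - t|) := by
    intro r hr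
    have hsub' : uIcc t r ⊆ Icc 0 T := (uIcc_subset_uIcc_left hr).trans hsub
    refine (eLpNorm_sub_le_mul_abs_sub hc (fun x q hq => hF₁ x q (hsub' hq))
      (hc₂.mono (prod_mono_left hsub')) fun q hq => h q (hsub' hq)).trans ?_
    refine ENNReal.ofReal_le_ofReal (mul_le_mul_of_nonneg_left ?_ hc)
    exact abs_sub_left_of_mem_uIcc hr
  have hct : Continuous (F₁ t) :=
    hc₁.comp_continuous (f := fun x : ℝ => (t, x)) (by fun_prop) fun x => ⟨ht, mem_univ _⟩
  -- Subtracting r F₁(t, x) makes the Taylor remainder an increment whose time derivative is F₁(r) -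
  -- F₁(t), already of size c |s - t|.
  have h2 := eLpNorm_sub_le_mul_abs_sub (a := t) (b := s) (c := c * |s - t|) (by positivity)
    (F := fun r x => F r x - r * F₁ t x) (f := fun r x => F₁ r x - F₁ t x)
    (fun x r hr => (hF x r (hsub hr)).sub (by simpa using (hasDerivAt_id r).mul_const (F₁ t x)))
    ((hc₁.mono (prod_mono_left hsub)).sub (hct.comp continuous_snd).continuousOn) h1
  rw [mul_assoc, ← sq] at h2
  convert! h2 using 3
  ring

variable {α ρ T R : ℝ} {V : ℕ → ℝ → ℝ → ℝ}

/-- Space derivatives commute with time derivatives, so the second-order Taylor remainder of every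
∂ₓⁿ V_k is bounded through ∂ₓⁿ V_{k+2}, uniformly in time. Summing over n bounds the remainder in
B_{α,ρ} by a constant times (s - t)². -/
theorem hasDerivWithinAt_toBSpace (hρ : 0 < ρ) (hR : ρ < R)
    (ha : ∀ k, ∀ t ∈ Icc 0 T, ∀ x, AnalyticAt ℝ (Function.uncurry (V k)) (t, x))
    (hd : ∀ k, ∀ t ∈ Icc 0 T, timeDeriv (V k) t = V (k + 1) t)
    (hb : ∀ k, FactorialBound T R (V k)) (k : ℕ) {t : ℝ} (ht : t ∈ Icc 0 T) :
    HasDerivWithinAt (fun s => toBSpace α ρ (V k s)) (toBSpace α ρ (V (k + 1) t)) (Icc 0 T) t := by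
  obtain ⟨r, hρr, hrR⟩ := exists_between hR
  obtain ⟨K, hK0, hK⟩ := hb (k + 2) r (hρ.trans hρr) hrR
  obtain ⟨C, hC0, hC⟩ := exists_bENorm_le α hρ hρr
  have hsm : ∀ k, ∀ t ∈ Icc 0 T, ContDiff ℝ ∞ (V k t) := fun k t ht => contDiff_space (ha k t ht)
  have hto : ∀ k, ∀ t ∈ Icc 0 T, (toBSpace α ρ (V k t)).toFun = V k t := fun k t ht =>
    toFun_toBSpace (hsm k t ht) ((hb k).bENorm_ne_top hρ hR ht)
  have hder : ∀ k n, ∀ x, ∀ s ∈ Icc 0 T, HasDerivAt (fun s => (spaceDeriv^[n] (V k)) s x)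
      ((spaceDeriv^[n] (V (k + 1))) s x) s := by
    intro k n x s hs
    have h1 := ((ha k s hs x).spaceDeriv_iterate n).hasDerivAt_time
    rwa [timeDeriv_spaceDeriv_iterate (ha k s hs), ← iteratedDeriv_eq_spaceDeriv_iterate,
      hd k s hs, iteratedDeriv_eq_spaceDeriv_iterate] at h1
  have hcont : ∀ k n, ContinuousOn (Function.uncurry (spaceDeriv^[n] (V k))) (Icc 0 T ×ˢ univ) :=
    fun k n p hp =>
      ((ha k p.1 hp.1 p.2).spaceDeriv_iterate n).continuousAt.continuousWithinAt
  have hrem : ∀ s ∈ Icc 0 T, ‖toBSpace α ρ (V k s) - toBSpace α ρ (V k t) -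
      (s - t) • toBSpace α ρ (V (k + 1) t)‖ ≤ K * C * ‖s - t‖ ^ 2 := by
    intro s hs
    have h1 : (toBSpace α ρ (V k s) - toBSpace α ρ (V k t) -
        (s - t) • toBSpace α ρ (V (k + 1) t)).toFun =
        V k s - V k t - (s - t) • V (k + 1) t := by
      change (toBSpace α ρ (V k s)).toFun - (toBSpace α ρ (V k t)).toFun -
        (s - t) • (toBSpace α ρ (V (k + 1) t)).toFun = _
      rw [hto k s hs, hto k t ht, hto (k + 1) t ht]
    rw [BSpace.norm_def, h1]
    refine ENNReal.toReal_le_of_le_ofReal (by positivity) ?_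
    have h2 : K * C * ‖s - t‖ ^ 2 = K * ‖s - t‖ ^ 2 * C := by ring
    rw [h2]
    refine hC _ _ (by positivity) fun n => ?_
    have hcd : ∀ k, ∀ t ∈ Icc 0 T, ∀ x, ContDiffAt ℝ n (V k t) x := fun k t ht x =>
      (contDiff_nat_of_smooth (hsm k t ht) n).contDiffAt
    have h3 : iteratedDeriv n (V k s - V k t - (s - t) • V (k + 1) t) = fun x =>
        (spaceDeriv^[n] (V k)) s x - (spaceDeriv^[n] (V k)) t x -
          (s - t) * (spaceDeriv^[n] (V (k + 1))) t x := by
      ext x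
      have h4 : ContDiffAt ℝ n (V k s - V k t) x := (hcd k s hs x).sub (hcd k t ht x)
      have h5 : ContDiffAt ℝ n ((s - t) • V (k + 1) t) x := (hcd (k + 1) t ht x).const_smul (s - t)
      rw [iteratedDeriv_sub h4 h5, iteratedDeriv_sub (hcd k s hs x) (hcd k t ht x),
        iteratedDeriv_const_smul (hcd (k + 1) t ht x)]
      simp only [iteratedDeriv_eq_spaceDeriv_iterate, smul_eq_mul]
    rw [h3]
    have hr0 : 0 < r := hρ.trans hρr
    refine (eLpNorm_taylor_le (c := K * (n.factorial / r ^ n)) (by positivity) (hder k n)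
      (hder (k + 1) n) (hcont _ n) (hcont _ n) (fun q hq => ?_) ht hs).trans
      (le_of_eq (congrArg _ ?_))
    · rw [← iteratedDeriv_eq_spaceDeriv_iterate]
      exact hK n q hq
    · rw [Real.norm_eq_abs]
      ring
  rw [hasDerivWithinAt_iff_isLittleO]
  have hO : (fun s => toBSpace α ρ (V k s) - toBSpace α ρ (V k t) -
      (s - t) • toBSpace α ρ (V (k + 1) t)) =O[nhdsWithin t (Icc 0 T)]
        fun s => ‖s - t‖ ^ 2 := by
    refine Asymptotics.IsBigO.of_bound (K * C) ?_
    filter_upwards [self_mem_nhdsWithin] with s hs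
    rw [Real.norm_of_nonneg (sq_nonneg _)]
    exact hrem s hs
  exact hO.trans_isLittleO
    ((Asymptotics.isLittleO_pow_sub_sub t (by norm_num)).mono nhdsWithin_le_nhds)

theorem contDiffOn_of_hasDerivWithinAt_succ {E : Type*} [NormedAddCommGroup E] [NormedSpace ℝ E]
    {s : Set ℝ} (hs : UniqueDiffOn ℝ s) {U : ℕ → ℝ → E}
    (hU : ∀ k, ∀ t ∈ s, HasDerivWithinAt (U k) (U (k + 1) t) s t) (n k : ℕ) :
    ContDiffOn ℝ n (U k) s := by
  induction n generalizing k with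
  | zero =>
    exact contDiffOn_zero.2 fun t ht => (hU k t ht).continuousWithinAt
  | succ n ih =>
    push_cast
    rw [contDiffOn_succ_iff_derivWithin hs]
    refine ⟨fun t ht => (hU k t ht).differentiableWithinAt, by simp, ?_⟩
    exact (ih (k + 1)).congr fun t ht => (hU k t ht).derivWithin (hs t ht)

end TimeRegularity

/-! ### Closed form of the time derivatives of a solution -/

section BurgersTimeDerivatives

variable {T : ℝ} {u : ℝ → ℝ → ℝ}

/-- The `k`-th time derivative `(-1) ^ k / (k + 1) ∂ₓᵏ (u ^ (k + 1))` of a solution `u` of the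
Burgers equation. -/
noncomputable def burgersTimeDeriv (u : ℝ → ℝ → ℝ) (k : ℕ) (t x : ℝ) : ℝ :=
  (-1) ^ k / (k + 1) * (spaceDeriv^[k] fun t x => u t x ^ (k + 1)) t x

theorem burgersTimeDeriv_zero (u : ℝ → ℝ → ℝ) : burgersTimeDeriv u 0 = u := by
  ext t x
  simp [burgersTimeDeriv]

theorem analyticAt_uncurry_pow {t x : ℝ} (h : AnalyticAt ℝ (Function.uncurry u) (t, x)) (k : ℕ) :
    AnalyticAt ℝ (Function.uncurry fun t x => u t x ^ k) (t, x) :=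
  h.fun_pow k

theorem analyticAt_burgersTimeDeriv {t x : ℝ} (h : AnalyticAt ℝ (Function.uncurry u) (t, x))
    (k : ℕ) : AnalyticAt ℝ (Function.uncurry (burgersTimeDeriv u k)) (t, x) :=
  analyticAt_const.mul ((analyticAt_uncurry_pow h (k + 1)).spaceDeriv_iterate k)

/-- Powers of a solution obey ∂ₜ(u^m) = -(m / (m + 1)) ∂ₓ(u^(m+1)); take m = k + 1 and apply ∂ₓᵏ. -/
theorem timeDeriv_burgersTimeDeriv {t : ℝ} (ha : ∀ x, AnalyticAt ℝ (Function.uncurry u) (t, x))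
    (hu : ∀ x, timeDeriv u t x = -(u t x * spaceDeriv u t x)) (k : ℕ) :
    timeDeriv (burgersTimeDeriv u k) t = burgersTimeDeriv u (k + 1) t := by
  have h1 : timeDeriv (fun t x => u t x ^ (k + 1)) t =
      fun x => -((k + 1 : ℝ) / (k + 2)) * spaceDeriv (fun t x => u t x ^ (k + 2)) t x := by
    ext x
    have e1 : timeDeriv (fun t x => u t x ^ (k + 1)) t x = _ :=
      ((ha x).hasDerivAt_time.pow (k + 1)).deriv
    have e2 : spaceDeriv (fun t x => u t x ^ (k + 2)) t x = _ :=
      ((ha x).hasDerivAt_space.pow (k + 2)).deriv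
    rw [e1, e2, hu]
    have : (k + 2 : ℝ) ≠ 0 := by positivity
    simp only [Nat.add_sub_cancel, Nat.add_succ_sub_one]
    push_cast
    field_simp
    ring
  ext x
  have hP := fun x => analyticAt_uncurry_pow (ha x) (k + 1)
  have h2 : timeDeriv (burgersTimeDeriv u k) t x = (-1) ^ k / (k + 1) *
      timeDeriv (spaceDeriv^[k] fun t x => u t x ^ (k + 1)) t x :=
    (((hP x).spaceDeriv_iterate k).hasDerivAt_time.const_mul _).deriv
  rw [h2, timeDeriv_spaceDeriv_iterate hP, ← iteratedDeriv_eq_spaceDeriv_iterate, h1,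
    iteratedDeriv_const_mul_field, iteratedDeriv_eq_spaceDeriv_iterate, burgersTimeDeriv,
    ← Function.iterate_succ_apply]
  have h3 : (k + 1 : ℝ) ≠ 0 := by positivity
  have h4 : (k + 2 : ℝ) ≠ 0 := by positivity
  push_cast
  rw [show (k : ℝ) + 1 + 1 = k + 2 by ring]
  field_simp
  ring

theorem factorialBound_burgersTimeDeriv {R : ℝ} (hu : FactorialBound T R u)
    (hs : ∀ t ∈ Icc 0 T, ContDiff ℝ ∞ (u t)) (k : ℕ) :
    FactorialBound T R (burgersTimeDeriv u k) :=
  ((hu.pow_succ hs k).spaceDeriv_iterate k).const_mul _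

end BurgersTimeDerivatives

/-! ### Initial values in B_{α,ρ₀} and the resulting bounds -/

section InitialValue

variable {α ρ₀ : ℝ}

theorem BSpace.abs_iteratedDeriv_le (hρ : 0 < ρ₀) (u₀ : BSpace α ρ₀) (n : ℕ) (x : ℝ) :
    |iteratedDeriv n u₀.toFun x| ≤ ‖u₀‖ * bBound α ρ₀ n + ‖u₀‖ * bBound α ρ₀ (n + 1) :=
  abs_iteratedDeriv_le_of_eLpNorm_le u₀.smooth
    (mul_nonneg (norm_nonneg _) (bBound_pos α hρ _).le)
    (mul_nonneg (norm_nonneg _) (bBound_pos α hρ _).le)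
    (u₀.eLpNorm_iteratedDeriv_le hρ n) (u₀.eLpNorm_iteratedDeriv_le hρ (n + 1)) x

theorem BSpace.analyticAt (hα : 0 ≤ α) (hρ : 0 < ρ₀) (u₀ : BSpace α ρ₀) (x : ℝ) :
    AnalyticAt ℝ u₀.toFun x := by
  -- The sup bound costs one derivative, hence a factor n + 1 ≤ 2^n; this turns 1 / ρ₀ into 2 / ρ₀.
  refine analyticAt_of_iteratedDeriv_bound u₀.smooth (C := ‖u₀‖ * (1 + 1 / ρ₀)) (r := 2 / ρ₀)
    (by positivity) (fun n x => (u₀.abs_iteratedDeriv_le hρ n x).trans ?_) x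
  have h1 := bBound_le hα hρ n
  have h2 := bBound_le hα hρ (n + 1)
  have hn : (n : ℝ) + 1 ≤ 2 ^ n := by exact_mod_cast n.lt_two_pow_self
  have h1n : (1 : ℝ) ≤ 2 ^ n := one_le_pow₀ (by norm_num)
  have hf := factorial_cast_pos n
  have hM := norm_nonneg u₀
  rw [Nat.factorial_succ] at h2
  push_cast at h2
  calc ‖u₀‖ * bBound α ρ₀ n + ‖u₀‖ * bBound α ρ₀ (n + 1)
      ≤ ‖u₀‖ * (n.factorial / ρ₀ ^ n) + ‖u₀‖ * ((n + 1) * n.factorial / ρ₀ ^ (n + 1)) := by gcongr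
    _ = ‖u₀‖ * (1 + (n + 1) / ρ₀) * (1 / ρ₀ ^ n) * n.factorial := by
        rw [_root_.pow_succ]; field_simp
    _ ≤ ‖u₀‖ * (2 ^ n + 2 ^ n / ρ₀) * (1 / ρ₀ ^ n) * n.factorial := by gcongr
    _ = _ := by rw [div_pow]; ring

theorem BSpace.eLpNorm_lt_top (hρ : 0 < ρ₀) (u₀ : BSpace α ρ₀) (n : ℕ) :
    eLpNorm (iteratedDeriv n u₀.toFun) 2 volume ≠ ⊤ :=
  ne_top_of_le_ne_top ENNReal.ofReal_ne_top (u₀.eLpNorm_iteratedDeriv_le hρ n)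

theorem BSpace.abs_iteratedDeriv_le_toReal (hρ : 0 < ρ₀) (u₀ : BSpace α ρ₀) (n : ℕ) (x : ℝ) :
    |iteratedDeriv n u₀.toFun x| ≤ (eLpNorm (iteratedDeriv n u₀.toFun) 2 volume).toReal +
      (eLpNorm (iteratedDeriv (n + 1) u₀.toFun) 2 volume).toReal :=
  abs_iteratedDeriv_le_of_eLpNorm_le u₀.smooth ENNReal.toReal_nonneg ENNReal.toReal_nonneg
    (ENNReal.ofReal_toReal (u₀.eLpNorm_lt_top hρ n)).ge
    (ENNReal.ofReal_toReal (u₀.eLpNorm_lt_top hρ (n + 1))).ge x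

theorem BSpace.toReal_eLpNorm_le (hρ : 0 < ρ₀) (u₀ : BSpace α ρ₀) (n : ℕ) :
    (eLpNorm (iteratedDeriv n u₀.toFun) 2 volume).toReal ≤ ‖u₀‖ * bBound α ρ₀ n :=
  ENNReal.toReal_le_of_le_ofReal (mul_nonneg (norm_nonneg _) (bBound_pos α hρ _).le)
    (u₀.eLpNorm_iteratedDeriv_le hρ n)

/-- The `L²` bounds for the space derivatives of the solution of the Burgers equation. -/
theorem BSpace.eLpNorm_burgersSol_le (hα : 2 < α) (hρ : 0 < ρ₀) (u₀ : BSpace α ρ₀)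
    {L B T C γ : ℝ} (hL : ∀ x, |deriv u₀.toFun x| ≤ L) (hB : ∀ x, |u₀.toFun x| ≤ B)
    (hT : T * L ≤ 1 / 2) (hC0 : 0 ≤ C)
    (hC : ∀ n : ℕ, 3 ≤ n → ∑ j ∈ Finset.Ico 2 n, (n.choose j : ℝ) *
      ((bBound α ρ₀ (min j (n + 1 - j)) + 2 * bBound α ρ₀ (min j (n + 1 - j) + 1)) *
        bBound α ρ₀ (max j (n + 1 - j))) ≤ C * (n - 2) * bBound α ρ₀ n)
    (hγ : 8 * L + 16 * ‖u₀‖ * C ≤ γ) {t : ℝ} (ht : t ∈ Icc 0 T) (n : ℕ) :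
    eLpNorm (iteratedDeriv n (burgersSol u₀.toFun t)) 2 volume ≤
      ENNReal.ofReal (16 * ‖u₀‖ * bBound α (ρ₀ * Real.exp (-(γ * T))) n) := by
  have hfa := u₀.analyticAt (by linarith) hρ
  have hM := norm_nonneg u₀
  have hL0 : 0 ≤ L := (abs_nonneg _).trans (hL 0)
  have hγ0 : 0 ≤ γ := by
    have : 0 ≤ 8 * L + 16 * ‖u₀‖ * C := by positivity
    linarith
  have ht0 := ht.1
  have hT0 : 0 ≤ T := ht0.trans ht.2
  have htL : |t| * L ≤ 1 / 2 := by
    rw [abs_of_nonneg ht.1]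
    exact (mul_le_mul_of_nonneg_right ht.2 hL0).trans hT
  have hb0 : ∀ n, 0 ≤ bBound α ρ₀ n := fun n => (bBound_pos α hρ n).le
  have hlag : eLpNorm (lagDeriv u₀.toFun n t) 2 volume ≤
      ENNReal.ofReal (8 * ‖u₀‖ * bBound α ρ₀ n * Real.exp (γ * T * n)) := by
    have hMb : ∀ n, 0 ≤ ‖u₀‖ * bBound α ρ₀ n := fun n => mul_nonneg hM (hb0 n)
    -- Orders 0 and 1 lie outside the induction and follow from w_0 = f and J w_1 = f'.
    rcases lt_or_ge n 2 with hn | hn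
    · have h1 : ∀ x, |lagDeriv u₀.toFun n t x| ≤ 2 * |iteratedDeriv n u₀.toFun x| := by
        intro x
        interval_cases n
        · rw [lagDeriv_zero (fun x => (hfa x).differentiableAt) hL (by linarith), iteratedDeriv_zero]
          linarith [abs_nonneg (u₀.toFun x)]
        · rw [iteratedDeriv_one]
          exact abs_lagDeriv_one_le hfa hL hB htL x
      refine (eLpNorm_le_ofReal_mul h1).trans
        ((mul_le_mul' le_rfl (u₀.eLpNorm_iteratedDeriv_le hρ n)).trans ?_)
      rw [← ENNReal.ofReal_mul (by norm_num)]
      refine ENNReal.ofReal_le_ofReal ?_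
      have h2 : (1 : ℝ) ≤ Real.exp (γ * T * n) := Real.one_le_exp (by positivity)
      have h3 := hMb n
      nlinarith
    -- The convolution hypothesis is quadratic in A on the left and linear on the right, so scaling
    -- the weights by 8 ‖u₀‖ multiplies C by the same factor.
    · refine (eLpNorm_lagDeriv_le (A := fun n => 8 * ‖u₀‖ * bBound α ρ₀ n) (K := 8 * ‖u₀‖ * C)
        (γ := γ) hfa hL hB hT (fun n => by have := hb0 n; positivity) (fun n => ?_) (fun n hn => ?_)
        (by positivity) (by linarith) hn t ht).trans (ENNReal.ofReal_le_ofReal ?_)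
      · refine (u₀.eLpNorm_iteratedDeriv_le hρ n).trans (le_of_eq (congrArg _ ?_))
        ring
      · have h1 := mul_le_mul_of_nonneg_left (hC n hn) (by positivity : 0 ≤ (8 * ‖u₀‖) ^ 2)
        rw [Finset.mul_sum] at h1
        calc _ = _ := Finset.sum_congr rfl fun j _ => ?_
          _ ≤ _ := h1
          _ = _ := by ring
        ring
      · have h1 := hb0 n
        have hn2 : (2 : ℝ) ≤ n := by exact_mod_cast hn
        refine mul_le_mul_of_nonneg_left (Real.exp_le_exp.2 ?_) (by positivity)
        calc γ * (n - 2) * t ≤ γ * n * T := by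
              have := ht.2
              gcongr
              linarith
          _ = γ * T * n := by ring
  refine (eLpNorm_spaceDeriv_burgersSol_le hfa hL hB htL n).trans
    ((mul_le_mul' le_rfl hlag).trans ?_)
  rw [← ENNReal.ofReal_mul (by norm_num)]
  refine le_of_eq (congrArg _ ?_)
  -- Growth exp(γ T n) of the n-th derivative is exactly the shrinking of the radius from ρ₀ to ρ₀
  -- exp(-γ T).
  have h1 : bBound α (ρ₀ * Real.exp (-(γ * T))) n = bBound α ρ₀ n * Real.exp (γ * T * n) := by
    have h2 : Real.exp (-(γ * T)) ^ n = (Real.exp (γ * T * n))⁻¹ := by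
      rw [← Real.exp_nat_mul, ← Real.exp_neg]
      ring_nf
    have h3 := max_rpow_pos α n
    rw [bBound, bBound, mul_pow, h2]
    field_simp
  rw [h1]
  ring

end InitialValue

/-! ### The main theorem -/

theorem theorem4p4 :
    ∃ κ : ℝ, 0 < κ ∧ ∀ α ρ₀ : ℝ, 2 < α → 0 < ρ₀ →
      ∃ (c₃ : ℝ) (γ : ℝ → ℝ), 0 < c₃ ∧ (∀ M, 0 < γ M) ∧
        ∀ (u₀ : BSpace α ρ₀) (T ρ₁ : ℝ), 0 < T → T * sobolevH2Norm u₀.toFun ≤ κ →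
          ρ₁ = ρ₀ * Real.exp (-(γ ‖u₀‖ * T)) →
          ∃ u : ℝ → ℝ → ℝ,
            u 0 = u₀.toFun ∧
            IsBurgersSolution T u ∧
            AnalyticOnNhd ℝ (Function.uncurry u) (Icc 0 T ×ˢ univ) ∧
            (∀ (Ta : ℝ) (v : ℝ → ℝ → ℝ), 0 < Ta → IsBurgersSolution Ta v → v 0 = u₀.toFun →
              ∀ t ∈ Icc 0 (min Ta T), u t = v t) ∧
            ∀ ρ : ℝ, 0 < ρ → ρ < ρ₁ →
              ∃ U : ℝ → BSpace α ρ,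
                (∀ t ∈ Icc 0 T, (U t).toFun = u t) ∧
                (∀ k : ℕ, ContDiffOn ℝ k U (Icc 0 T)) ∧
                ∀ t ∈ Icc 0 T, ‖U t‖ ≤ c₃ * (ρ₁ / (ρ₁ - ρ)) * ‖u₀‖ := by
  refine ⟨1 / 2, by norm_num, fun α ρ₀ hα hρ₀ => ?_⟩
  obtain ⟨C, hC0, hC⟩ := exists_sum_choose_mul_bBound_le hα hρ₀
  have hb := bBound_pos α hρ₀
  -- The 16 is 2 from the change of variables times 8 from the induction. In γ, the first term
  -- dominates 8 L through the norm of the initial value and the second is the convolution constant;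
  -- |M| and + 1 make γ positive on all of ℝ.
  refine ⟨16, fun M => 8 * (|M| * (bBound α ρ₀ 1 + bBound α ρ₀ 2)) + 16 * |M| * C + 1, by norm_num,
    fun M => by have := hb 1; have := hb 2; positivity, fun u₀ T ρ₁ hT hκ hρ₁ => ?_⟩
  simp only [abs_norm] at hρ₁
  set γ := 8 * (‖u₀‖ * (bBound α ρ₀ 1 + bBound α ρ₀ 2)) + 16 * ‖u₀‖ * C + 1 with hγ
  set f := u₀.toFun with hf
  set e : ℕ → ℝ := fun n => (eLpNorm (iteratedDeriv n f) 2 volume).toReal with he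
  set L := e 1 + e 2 with hLdef
  have he0 : ∀ n, 0 ≤ e n := fun n => ENNReal.toReal_nonneg
  have hL0 : 0 ≤ L := add_nonneg (he0 1) (he0 2)
  have hfa := u₀.analyticAt (by linarith) hρ₀
  have hfd : Differentiable ℝ f := fun x => (hfa x).differentiableAt
  have hL : ∀ x, |deriv f x| ≤ L := fun x => by
    rw [← iteratedDeriv_one]
    exact u₀.abs_iteratedDeriv_le_toReal hρ₀ 1 x
  have hB : ∀ x, |f x| ≤ e 0 + e 1 := fun x => u₀.abs_iteratedDeriv_le_toReal hρ₀ 0 x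
  -- Only the L² norms of f' and f'' enter L, and both are part of the H² norm; κ = 1/2 is what
  -- keeps J at least 1/2.
  have hTL : T * L ≤ 1 / 2 := by
    refine le_trans (mul_le_mul_of_nonneg_left ?_ hT.le) hκ
    rw [sobolevH2Norm, Finset.sum_range_succ, Finset.sum_range_succ, Finset.sum_range_one]
    change e 1 + e 2 ≤ e 0 + e 1 + e 2
    linarith [he0 0]
  have htL : ∀ t ∈ Icc 0 T, |t| * L < 1 := fun t ht => by
    rw [abs_of_nonneg ht.1]
    linarith [mul_le_mul_of_nonneg_right ht.2 hL0]
  have hLM : 8 * L + 16 * ‖u₀‖ * C ≤ γ := by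
    have h1 := u₀.toReal_eLpNorm_le hρ₀ 1
    have h2 := u₀.toReal_eLpNorm_le hρ₀ 2
    have h3 : L ≤ ‖u₀‖ * (bBound α ρ₀ 1 + bBound α ρ₀ 2) := by
      rw [mul_add]
      exact add_le_add h1 h2
    linarith
  set u := burgersSol f with hu
  have hua : ∀ t ∈ Icc 0 T, ∀ x, AnalyticAt ℝ (Function.uncurry u) (t, x) := fun t ht x =>
    analyticAt_burgersSol hfa hL hB (htL t ht) x
  have hbound : ∀ n, ∀ t ∈ Icc 0 T, eLpNorm (iteratedDeriv n (u t)) 2 volume ≤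
      ENNReal.ofReal (16 * ‖u₀‖ * bBound α ρ₁ n) := fun n t ht => by
    rw [hρ₁]
    exact u₀.eLpNorm_burgersSol_le hα hρ₀ hL hB hTL hC0 hC hLM ht n
  have hus : ∀ t ∈ Icc 0 T, ContDiff ℝ ∞ (u t) := fun t ht => contDiff_space (hua t ht)
  refine ⟨u, burgersSol_zero f, isBurgersSolution_burgersSol hfa hL hB htL,
    fun p hp => hua p.1 hp.1 p.2, fun Ta v hTa hv hv0 t ht => ?_, fun ρ hρ hρlt => ?_⟩
  · have htT : t ∈ Icc 0 T := ⟨ht.1, ht.2.trans (min_le_right _ _)⟩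
    ext y
    obtain ⟨x, rfl⟩ := flowMap_surjective (t := t) hfd hB y
    have h1 := hv.apply_flowMap hTa ⟨ht.1, ht.2.trans (min_le_left _ _)⟩ x
    rw [hv0] at h1
    rw [h1]
    exact burgersSol_flowMap hfd hL (htL t htT) x
  · have hFB : FactorialBound T ρ₁ u := by
      intro r hr hrR
      refine ⟨16 * ‖u₀‖, by positivity, fun n t ht => (hbound n t ht).trans ?_⟩
      refine ENNReal.ofReal_le_ofReal ?_
      refine mul_le_mul_of_nonneg_left ?_ (by positivity)
      refine (bBound_le (by linarith) (hr.trans hrR) n).trans ?_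
      have := factorial_cast_pos n
      gcongr
    have hto : ∀ t ∈ Icc 0 T, (toBSpace α ρ (u t)).toFun = u t := fun t ht =>
      toFun_toBSpace (hus t ht) (hFB.bENorm_ne_top hρ hρlt ht)
    refine ⟨fun t => toBSpace α ρ (u t), hto, fun k => ?_, fun t ht => ?_⟩
    · have h := contDiffOn_of_hasDerivWithinAt_succ (uniqueDiffOn_Icc hT)
        (U := fun k s => toBSpace α ρ (burgersTimeDeriv u k s))
        (fun k t ht => hasDerivWithinAt_toBSpace hρ hρlt
          (fun k t ht x => analyticAt_burgersTimeDeriv (hua t ht x) k)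
          (fun k t ht => timeDeriv_burgersTimeDeriv (hua t ht)
            (fun x => timeDeriv_burgersSol hfa hL hB (htL t ht) x) k)
          (fun k => factorialBound_burgersTimeDeriv hFB hus k) k ht) k 0
      simpa only [burgersTimeDeriv_zero] using h
    · rw [BSpace.norm_def, hto t ht]
      have h1 : 0 < ρ₁ - ρ := sub_pos.2 hρlt
      have h2 : 0 < ρ₁ := hρ.trans hρlt
      refine ENNReal.toReal_le_of_le_ofReal (by positivity) ?_
      refine (bENorm_le_of_eLpNorm_le hρ.le hρlt (by positivity) fun n => hbound n t ht).trans
        (le_of_eq (congrArg _ ?_))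
      ring
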